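/- Let $p$ be a prime, $G=\mathrm{GL}_2(\mathbb{Q}_p)$ with center $Z$, $K=\mathrm{GL}_2(\mathbb{Z}_p)$, and let $I\subset K$ be the Iwahori subgroup of matrices that are upper triangular mod $p$. Let $k$ be a field of characteristic $p$ (for example $\overline{\mathbb{F}}_p$), let $0\le r\le p-1$, $\lambda\in k$, and let $\eta:\mathbb{Q}_p^\times\to k^\times$ be a smooth character, regarded as the character $\eta\circ\det$ of $G$. Let $V_r$ be the space of homogeneous polynomials $v(X,Y)$ of degree $r$ over $k$, on which $K$ acts through reduction mod $p$ by $\left(\begin{smallmatrix}a&b\\c&d\end{smallmatrix}\right)\cdot v(X,Y)=v(aX+cY,bX+dY)$ and $p\in Z$ acts trivially. Let $d^r$ be the character of $IZ$ with values in $k^\times$ sending $\left(\begin{smallmatrix}a&b\\c&d\end{smallmatrix}\right)\in I$ to $d^r \bmod p$ and $p\in Z$ to $1$. For $H\in\{KZ,IZ\}$ and a representation $\rho$ of $H$ on $V$, let $\mathrm{ind}_H^G\rho$ be the space of functions $f:G\to V$ that are supported on finitely many right cosets of $H$ and satisfy $f(hg)=\rho(h)f(g)$ for $h\in H$, $g\in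 G$, with $G$ acting by $(g\cdot f)(g')=f(g'g)$. For $g\in G$ and $v\in V$ let $[g,v]\in\mathrm{ind}_H^G\rho$ be the function with $[g,v](g')=\rho(g'g)v$ if $g'g\in H$ and $[g,v](g')=0$ otherwise; these functions span $\mathrm{ind}_H^G\rho$; write $\llbracket g,v\rrbracket$ instead of $[g,v]$ when $H=IZ$. Put $\alpha=\left(\begin{smallmatrix}1&0\\0&p\end{smallmatrix}\right)$ and $\beta=\left(\begin{smallmatrix}0&1\\p&0\end{smallmatrix}\right)$, and let $[x]\in\mathbb{Z}_p$ be the Teichmüller representative of $x\in\mathbb{F}_p$. Let $T$ be the $k$-linear, $G$-equivariant endomorphism of $\mathrm{ind}_{KZ}^GV_r$ with $$T[g,v]=\sum_{x\in\mathbb{F}_p}\left[g\left(\begin{smallmatrix}p&[x]\\0&1\end{smallmatrix}\right),\,v(X,-[x]X+pY)\right]+[g\alpha,\,v(pX,Y)],$$ and let $T_{-1,0}$, $T_{1,2}$ and, for $r\in\{0,p-1\}$ only, $T_{1,0}$ be the $k$-linear, $G$-equivariant endomorphisms of $\mathrm{ind}_{IZ}^Gd^r$ with $$T_{-1,0}\llbracket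 g,v\rrbracket=\sum_{x\in\mathbb{F}_p}\left\llbracket g\left(\begin{smallmatrix}p&[x]\\0&1\end{smallmatrix}\right),v\right\rrbracket,\qquad T_{1,2}\llbracket g,v\rrbracket=\sum_{x\in\mathbb{F}_p}\left\llbracket g\left(\begin{smallmatrix}1&0\\p[x]&p\end{smallmatrix}\right),v\right\rrbracket,\qquad T_{1,0}\llbracket g,v\rrbracket=\llbracket g\beta,v\rrbracket.$$ **Theorem (Anandavardhanan, Borisagar, Chitrao).** The spherical and the Iwahori definitions of $\pi(r,\lambda,\eta)$ coincide, that is, there is a $k$-linear $G$-equivariant isomorphism $$\frac{\mathrm{ind}_{KZ}^GV_r}{\mathrm{Im}(T-\lambda)}\otimes\eta\;\simeq\;\frac{\mathrm{ind}_{IZ}^Gd^r}{\mathrm{Im}(T_{-1,0}+\delta_{r,p-1}T_{1,0})+\mathrm{Im}(T_{1,2}+\delta_{r,0}T_{1,0}-\lambda)}\otimes\eta ,$$ where $\delta_{i,j}$ is $1$ if $i=j$ and $0$ otherwise (a term with coefficient $\delta=0$ is omitted). -/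

import Mathlib

namespace ABC

/-! ### Compact induction -/

section CompactInduction

variable {k G H V : Type*} [CommRing k] [Group G] [Group H] [AddCommGroup V] [Module k V]

/-- The underlying space of the compact induction of the representation `ρ` of `H` along an
(injective) homomorphism `ι : H →* G`: the functions `f : G → V` such that
`f (ι h * g) = ρ h (f g)` and which are supported on finitely many right cosets of `ι H`. -/
def cIndV (ι : H →* G) (ρ : Representation k H V) : Submodule k (G → V) where
  carrier := {f | (∀ h g, f (ι h * g) = ρ h (f g)) ∧
    ∃ S : Finset G, ∀ g, f g ≠ 0 → ∃ s ∈ S, ∃ h, g = ι h * s}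
  add_mem' := by
    classical
    rintro f f' ⟨hf, S, hS⟩ ⟨hf', S', hS'⟩
    refine ⟨fun h g => by simp [hf, hf'], S ∪ S', fun g hg => ?_⟩
    by_cases h0 : f g = 0
    · have : f' g ≠ 0 := fun h1 => hg (by simp [h0, h1])
      obtain ⟨s, hs, h⟩ := hS' g this
      exact ⟨s, Finset.mem_union_right _ hs, h⟩
    · obtain ⟨s, hs, h⟩ := hS g h0
      exact ⟨s, Finset.mem_union_left _ hs, h⟩
  zero_mem' := ⟨by simp, ∅, by simp⟩
  smul_mem' := by
    rintro c f ⟨hf, S, hS⟩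
    refine ⟨fun h g => by simp [hf], S, fun g hg => hS g fun h0 => hg (by simp [h0])⟩

/-- The compact induction of `ρ` along `ι`: the group `G` acts on `cIndV ι ρ` by
`(g • f) x = f (x * g)`. -/
def cInd (ι : H →* G) (ρ : Representation k H V) : Representation k G (cIndV ι ρ) where
  toFun g := (LinearMap.funLeft k V (· * g)).restrict (by
    rintro f ⟨hf, S, hS⟩
    classical
    refine ⟨fun h x => by simp [LinearMap.funLeft_apply, mul_assoc, hf], S.image (· * g⁻¹),
      fun x hx => ?_⟩
    obtain ⟨s, hs, h, e⟩ := hS _ hx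
    exact ⟨s * g⁻¹, Finset.mem_image_of_mem _ hs, h, by rw [← mul_assoc, ← e]; simp⟩)
  map_one' := by ext; simp [LinearMap.funLeft_apply]
  map_mul' _ _ := by ext; simp [LinearMap.funLeft_apply, mul_assoc]

variable {ι : H →* G} {ρ : Representation k H V}

theorem cInd_apply (g : G) (f : cIndV ι ρ) (x : G) : (cInd ι ρ g f).1 x = f.1 (x * g) := rfl

open Classical in
/-- The elementary function `[g, v]`, as a function on `G`: it sends `x` to `(x * g) · v` if
`x * g` lies in (the image of) `H`, and to `0` otherwise. -/
noncomputable def elemFun (ι : H →* G) (ρ : Representation k H V) (g : G) (v : V) : G → V :=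
  fun x => if h : ∃ y, ι y = x * g then ρ h.choose v else 0

theorem elemFun_of_eq (hι : Function.Injective ι) {g x : G} {y : H} (h : ι y = x * g) (v : V) :
    elemFun ι ρ g v x = ρ y v := by
  have hex : ∃ y, ι y = x * g := ⟨y, h⟩
  have : hex.choose = y := hι (hex.choose_spec.trans h.symm)
  rw [elemFun, dif_pos hex, this]

theorem elemFun_of_not {g x : G} (h : ¬ ∃ y, ι y = x * g) (v : V) :
    elemFun ι ρ g v x = 0 := by
  rw [elemFun, dif_neg h]

theorem elemFun_mem (hι : Function.Injective ι) (g : G) (v : V) :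
    elemFun ι ρ g v ∈ cIndV ι ρ := by
  refine ⟨fun h x => ?_, {g⁻¹}, fun x hx => ?_⟩
  · by_cases hex : ∃ y, ι y = x * g
    · obtain ⟨y, hy⟩ := hex
      rw [elemFun_of_eq hι hy, elemFun_of_eq hι (y := h * y) (by rw [map_mul, hy, mul_assoc])]
      simp
    · rw [elemFun_of_not hex, elemFun_of_not, map_zero]
      rintro ⟨y, hy⟩
      exact hex ⟨h⁻¹ * y, by rw [map_mul, hy]; simp [mul_assoc]⟩
  · by_contra hcon
    apply hx
    apply elemFun_of_not
    rintro ⟨y, hy⟩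
    exact hcon ⟨g⁻¹, by simp, y, by simp [hy]⟩

/-- The elementary function `[g, v]` as an element of the compact induction. -/
noncomputable def elem (hι : Function.Injective ι) (ρ : Representation k H V) (g : G) (v : V) :
    cIndV ι ρ := ⟨elemFun ι ρ g v, elemFun_mem hι g v⟩

variable (hι : Function.Injective ι)

theorem elem_add (g : G) (v w : V) : elem hι ρ g (v + w) = elem hι ρ g v + elem hι ρ g w := by
  ext x
  simp only [elem, Submodule.coe_add, Pi.add_apply, elemFun]
  split_ifs <;> simp

theorem elem_smul (g : G) (c : k) (v : V) : elem hι ρ g (c • v) = c • elem hι ρ g v := by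
  ext x
  simp only [elem, Submodule.coe_smul, Pi.smul_apply, elemFun]
  split_ifs <;> simp

theorem elem_zero (g : G) : elem hι ρ g 0 = 0 := by
  simpa using elem_smul hι (ρ := ρ) g 0 0

theorem cInd_elem (x g : G) (v : V) : cInd ι ρ x (elem hι ρ g v) = elem hι ρ (x * g) v := by
  ext y
  rw [cInd_apply]
  by_cases hex : ∃ z, ι z = y * x * g
  · obtain ⟨z, hz⟩ := hex
    exact (elemFun_of_eq hι hz v).trans (elemFun_of_eq hι (by rw [hz, mul_assoc]) v).symm
  · exact (elemFun_of_not hex v).trans (elemFun_of_not (by rwa [← mul_assoc]) v).symm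

theorem elem_mul (g : G) (h : H) (v : V) :
    elem hι ρ (g * ι h) v = elem hι ρ g (ρ h v) := by
  ext x
  simp only [elem]
  by_cases hex : ∃ y, ι y = x * g
  · obtain ⟨y, hy⟩ := hex
    rw [elemFun_of_eq hι hy, elemFun_of_eq hι (y := y * h) (by rw [map_mul, hy, mul_assoc])]
    simp
  · rw [elemFun_of_not hex, elemFun_of_not]
    rintro ⟨y, hy⟩
    exact hex ⟨y * h⁻¹, by rw [map_mul, hy]; simp [mul_assoc]⟩

/-- An element of the compact induction is nonzero on only finitely many right cosets; here the
right coset `ι(H) g⁻¹` is indexed by the left coset `g ι(H)`. -/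
theorem finite_support (f : cIndV ι ρ) :
    {c : G ⧸ ι.range | f.1 (c.out)⁻¹ ≠ 0}.Finite := by
  obtain ⟨f, hf, S, hS⟩ := f
  refine (S.finite_toSet.image fun s => ((s⁻¹ : G) : G ⧸ ι.range)).subset ?_
  intro c hc
  obtain ⟨s, hs, h, e⟩ := hS _ hc
  refine ⟨s, hs, ?_⟩
  rw [← QuotientGroup.out_eq' c]
  apply QuotientGroup.eq.2
  refine ⟨h⁻¹, ?_⟩
  have : c.out = s⁻¹ * (ι h)⁻¹ := by rw [← inv_inv c.out, e, mul_inv_rev]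
  rw [this]
  simp

/-- The operator on the compact induction which sends every elementary function `[g, v]` to
`∑ j, [g * m j, A j v]`; see `heckeOp_elem`. Every `f` is the sum of the elementary functions
`[g, f g⁻¹]`, where `g` runs over representatives of the left cosets of `ι H`. -/
noncomputable def heckeOp {J : Type*} [Fintype J] (ρ : Representation k H V) (m : J → G)
    (A : J → V →ₗ[k] V) : cIndV ι ρ →ₗ[k] cIndV ι ρ where
  toFun f := ∑ᶠ c : G ⧸ ι.range, ∑ j, elem hι ρ (c.out * m j) (A j (f.1 (c.out)⁻¹))
  map_add' f f' := by
    rw [← finsum_add_distrib]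
    · refine finsum_congr fun c => ?_
      rw [← Finset.sum_add_distrib]
      exact Finset.sum_congr rfl fun j _ => by simp [elem_add]
    · refine (finite_support f).subset fun c hc h0 => hc ?_
      simp [h0, elem_zero]
    · refine (finite_support f').subset fun c hc h0 => hc ?_
      simp [h0, elem_zero]
  map_smul' a f := by
    rw [RingHom.id_apply, smul_finsum' a]
    · refine finsum_congr fun c => ?_
      rw [Finset.smul_sum]
      exact Finset.sum_congr rfl fun j _ => by simp [elem_smul]
    · refine (finite_support f).subset fun c hc h0 => hc ?_
      simp [h0, elem_zero]

variable {J : Type*} [Fintype J] {m : J → G} {A : J → V →ₗ[k] V}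

theorem heckeOp_elem
    (hc : ∀ h v, ∑ j, elem hι ρ (ι h * m j) (A j v) = ∑ j, elem hι ρ (m j) (A j (ρ h v)))
    (g : G) (v : V) :
    heckeOp hι ρ m A (elem hι ρ g v) = ∑ j, elem hι ρ (g * m j) (A j v) := by
  have key : heckeOp hι ρ m A (elem hι ρ g v) = ∑ᶠ c : G ⧸ ι.range,
    ∑ j, elem hι ρ (c.out * m j) (A j ((elem hι ρ g v).1 (c.out)⁻¹)) := rfl
  rw [key, finsum_eq_single _ (g : G ⧸ ι.range)]
  · obtain ⟨⟨_, h, rfl⟩, e⟩ := QuotientGroup.mk_out_eq_mul ι.range g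
    simp only at e
    have e2 : (elem hι ρ g v).1 ((g : G ⧸ ι.range).out)⁻¹ = ρ h⁻¹ v :=
      elemFun_of_eq hι (by rw [e]; simp) v
    rw [e2, e]
    have := congrArg (cInd ι ρ g) (hc h (ρ h⁻¹ v))
    simpa [map_sum, cInd_elem, mul_assoc, ← Module.End.mul_apply, ← map_mul] using this
  · intro c hcg
    have : (elem hι ρ g v).1 (c.out)⁻¹ = 0 := by
      apply elemFun_of_not
      rintro ⟨y, hy⟩
      apply hcg
      rw [← QuotientGroup.out_eq' c]
      exact QuotientGroup.eq.2 ⟨y, hy⟩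
    simp [this, elem_zero]

/-- The elementary functions span the compact induction. -/
theorem eq_finsum (f : cIndV ι ρ) :
    f = ∑ᶠ c : G ⧸ ι.range, elem hι ρ c.out (f.1 (c.out)⁻¹) := by
  ext x
  have hfin : (Function.support fun c : G ⧸ ι.range =>
      elem hι ρ c.out (f.1 (c.out)⁻¹)).Finite :=
    (finite_support f).subset fun c hc h0 => hc (by simp [h0, elem_zero])
  have := ((LinearMap.proj x : (G → V) →ₗ[k] V).comp
    (cIndV ι ρ).subtype).toAddMonoidHom.map_finsum hfin
  refine Eq.trans ?_ this.symm
  rw [finsum_eq_single _ ((x⁻¹ : G) : G ⧸ ι.range)]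
  · obtain ⟨⟨_, h, rfl⟩, e⟩ := QuotientGroup.mk_out_eq_mul ι.range x⁻¹
    simp only at e
    have : elemFun ι ρ ((x⁻¹ : G) : G ⧸ ι.range).out (f.1 (((x⁻¹ : G) : G ⧸ ι.range).out)⁻¹) x
        = f.1 x := by
      rw [elemFun_of_eq hι (y := h) (by rw [e]; simp), ← f.2.1, e]
      simp
    exact this.symm
  · intro c hc
    have : elemFun ι ρ c.out (f.1 (c.out)⁻¹) x = 0 := by
      apply elemFun_of_not
      rintro ⟨y, hy⟩
      apply hc
      rw [← QuotientGroup.out_eq' c]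
      exact QuotientGroup.eq.2 ⟨y⁻¹, by rw [map_inv, hy]; simp⟩
    exact this

theorem heckeOp_comm
    (hc : ∀ h v, ∑ j, elem hι ρ (ι h * m j) (A j v) = ∑ j, elem hι ρ (m j) (A j (ρ h v)))
    (g : G) (f : cIndV ι ρ) :
    heckeOp hι ρ m A (cInd ι ρ g f) = cInd ι ρ g (heckeOp hι ρ m A f) := by
  have hfin : (Function.support fun c : G ⧸ ι.range =>
      elem hι ρ c.out (f.1 (c.out)⁻¹)).Finite :=
    (finite_support f).subset fun c hc h0 => hc (by simp [h0, elem_zero])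
  have key (L : cIndV ι ρ →ₗ[k] cIndV ι ρ) : L f =
      ∑ᶠ c : G ⧸ ι.range, L (elem hι ρ c.out (f.1 (c.out)⁻¹)) := by
    conv_lhs => rw [eq_finsum hι f]
    exact L.toAddMonoidHom.map_finsum hfin
  refine (key ((heckeOp hι ρ m A).comp (cInd ι ρ g))).trans
    (Eq.trans (finsum_congr fun c => ?_) (key ((cInd ι ρ g).comp (heckeOp hι ρ m A))).symm)
  simp [cInd_elem, heckeOp_elem hι hc, mul_assoc]

/-- A criterion for the formula of `heckeOp` to be well defined. -/
theorem compat_of_perm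
    (hex : ∀ h : H, ∃ (s : J → J) (h' : J → H), Function.Injective s ∧
      ∀ j, ι h * m j = m (s j) * ι (h' j) ∧ ∀ v, ρ (h' j) (A j v) = A (s j) (ρ h v))
    (h : H) (v : V) :
    ∑ j, elem hι ρ (ι h * m j) (A j v) = ∑ j, elem hι ρ (m j) (A j (ρ h v)) := by
  obtain ⟨s, h', hs, hj⟩ := hex h
  have hb : Function.Bijective s := Finite.injective_iff_bijective.1 hs
  refine Fintype.sum_bijective s hb _ _ fun j => ?_
  rw [(hj j).1, elem_mul, (hj j).2]

/-- The twist `σ ⊗ χ` of a representation by a character. -/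
def twist (σ : Representation k G V) (χ : G →* kˣ) : Representation k G V where
  toFun g := (χ g : k) • σ g
  map_one' := by simp
  map_mul' g g' := by
    ext v
    simp [smul_smul, mul_comm]

end CompactInduction

/-! ### The groups `K`, `I`, `KZ`, `IZ` -/

section Groups

variable (p : ℕ) [Fact p.Prime]

/-- The inclusion `GL₂(ℤ_p) → GL₂(ℚ_p)`; its image is the maximal compact subgroup `K`. -/
noncomputable def inclK : GL (Fin 2) ℤ_[p] →* GL (Fin 2) ℚ_[p] :=
  Matrix.GeneralLinearGroup.map (algebraMap ℤ_[p] ℚ_[p])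

/-- The scalar matrix `p` in `GL₂(ℚ_p)`. -/
noncomputable def pScalar : GL (Fin 2) ℚ_[p] :=
  Matrix.GeneralLinearGroup.scalar (Fin 2)
    (Units.mk0 (p : ℚ_[p]) (Nat.cast_ne_zero.2 (Fact.out : p.Prime).ne_zero))

theorem pScalar_comm (g : GL (Fin 2) ℚ_[p]) : pScalar p * g = g * pScalar p :=
  Matrix.GeneralLinearGroup.scalar_commute _ _

/-- The group `KZ` in the form `GL₂(ℤ_p) × p^ℤ`, with its embedding `(k, n) ↦ k * p ^ n` into
`GL₂(ℚ_p)`. It is injective and its image is `KZ`; see `inclKZ_injective` and `range_inclKZ`. -/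
noncomputable def inclKZ : GL (Fin 2) ℤ_[p] × Multiplicative ℤ →* GL (Fin 2) ℚ_[p] where
  toFun x := inclK p x.1 * pScalar p ^ x.2.toAdd
  map_one' := by simp
  map_mul' x y := by
    have hc : Commute (pScalar p ^ x.2.toAdd) (inclK p y.1) :=
      (show Commute (pScalar p) _ from pScalar_comm p _).zpow_left _
    simp only [Prod.fst_mul, Prod.snd_mul, toAdd_mul, map_mul, zpow_add]
    rw [mul_assoc, mul_assoc, ← mul_assoc (inclK p y.1), ← hc.eq, mul_assoc]

/-- The Iwahori subgroup `I` of `GL₂(ℤ_p)`: the matrices which are upper triangular mod `p`. -/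
def iwahori : Subgroup (GL (Fin 2) ℤ_[p]) where
  carrier := {g | PadicInt.toZMod (g.1 1 0) = 0}
  one_mem' := by simp
  mul_mem' {a b} ha hb := by
    simp only [Set.mem_ofPred_eq] at *
    simp [Matrix.mul_apply, Fin.sum_univ_two, ha, hb]
  inv_mem' {a} ha := by
    simp only [Set.mem_ofPred_eq] at *
    simp [Matrix.inv_def, Matrix.adjugate_fin_two, ha]

/-- The group `IZ` in the form `I × p^ℤ`, with its embedding into `GL₂(ℚ_p)`. It is
injective and its image is `IZ`; see `inclIZ_injective` and `range_inclIZ`. -/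
noncomputable def inclIZ : iwahori p × Multiplicative ℤ →* GL (Fin 2) ℚ_[p] :=
  (inclKZ p).comp ((iwahori p).subtype.prodMap (MonoidHom.id _))

variable {p}

theorem inclKZ_injective : Function.Injective (inclKZ p) := by
  rw [injective_iff_map_eq_one]
  rintro ⟨g, n⟩ h
  have hp : (p : ℚ_[p]) ≠ 0 := Nat.cast_ne_zero.2 (Fact.out : p.Prime).ne_zero
  have hn : n.toAdd = 0 := by
    have h1 := congrArg (fun x : GL (Fin 2) ℚ_[p] => ((Matrix.GeneralLinearGroup.det x : ℚ_[p]ˣ) :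
      ℚ_[p]).valuation) h
    have h2 : ‖((Matrix.GeneralLinearGroup.det g : ℤ_[p]ˣ) : ℤ_[p])‖ = 1 := PadicInt.norm_units _
    have h3 := congrArg (fun x : GL (Fin 2) ℚ_[p] =>
      ‖((Matrix.GeneralLinearGroup.det x : ℚ_[p]ˣ) : ℚ_[p])‖) h
    have h4 : ((Matrix.GeneralLinearGroup.det (inclK p g) : ℚ_[p]ˣ) : ℚ_[p]) =
        ((Matrix.GeneralLinearGroup.det g : ℤ_[p]ˣ) : ℤ_[p]) := by
      rw [inclK, Matrix.GeneralLinearGroup.map_det]; rfl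
    simp only [inclKZ, MonoidHom.coe_mk, OneHom.coe_mk, map_mul, Units.val_mul, norm_mul, h4,
      map_zpow, pScalar, Matrix.GeneralLinearGroup.det_scalar, map_one, Units.val_one,
      norm_one, Units.val_zpow_eq_zpow_val, Units.val_pow_eq_pow_val, Units.val_mk0,
      norm_zpow, norm_pow, PadicInt.padic_norm_e_of_padicInt, h2, one_mul, Fintype.card_fin,
      Padic.norm_p] at h3
    have hp1 : (1 : ℝ) < p := by exact_mod_cast (Fact.out : p.Prime).one_lt
    have h5 : ((p : ℝ)⁻¹ ^ 2) ^ n.toAdd = ((p : ℝ)⁻¹ ^ 2) ^ (0 : ℤ) := by simpa using h3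
    refine zpow_right_injective₀ (by positivity) ?_ h5
    have : (p : ℝ)⁻¹ ^ 2 < 1 := pow_lt_one₀ (by positivity) (inv_lt_one_of_one_lt₀ hp1) (by simp)
    exact this.ne
  have hn' : n = 1 := hn
  subst hn'
  have hg : inclK p g = 1 := by simpa [inclKZ] using h
  have : g = 1 := by
    ext i j
    have := congrArg (fun x : GL (Fin 2) ℚ_[p] => x.1 i j) hg
    apply Subtype.coe_injective
    refine this.trans ?_
    by_cases hij : i = j <;> simp [hij]
  rw [this]; rfl

theorem inclIZ_injective : Function.Injective (inclIZ p) := by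
  apply inclKZ_injective.comp
  rintro ⟨a, n⟩ ⟨b, m⟩ h
  simpa using h

theorem range_aux (L : Subgroup (GL (Fin 2) ℤ_[p]))
    (hL : ∀ u : ℤ_[p]ˣ, Matrix.GeneralLinearGroup.scalar (Fin 2) u ∈ L)
    (f : L × Multiplicative ℤ →* GL (Fin 2) ℚ_[p])
    (hf : ∀ x, f x = inclK p x.1 * pScalar p ^ x.2.toAdd) :
    f.range = L.map (inclK p) ⊔ Subgroup.center (GL (Fin 2) ℚ_[p]) := by
  apply le_antisymm
  · rintro _ ⟨x, rfl⟩
    rw [hf]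
    refine mul_mem (Subgroup.mem_sup_left ⟨_, x.1.2, rfl⟩) (Subgroup.mem_sup_right ?_)
    exact zpow_mem (Subgroup.mem_center_iff.2 fun g => (pScalar_comm p g).symm) _
  · refine sup_le ?_ ?_
    · rintro _ ⟨x, hx, rfl⟩
      exact ⟨(⟨x, hx⟩, 1), by simp [hf]⟩
    · rw [Matrix.GeneralLinearGroup.center_eq_range_scalar]
      rintro _ ⟨u, rfl⟩
      have hp : (p : ℚ_[p]) ≠ 0 := Nat.cast_ne_zero.2 (Fact.out : p.Prime).ne_zero
      have hu : ‖(u : ℚ_[p]) * (p : ℚ_[p]) ^ (-(u : ℚ_[p]).valuation)‖ = 1 := by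
        have hp0 : (p : ℝ) ≠ 0 := Nat.cast_ne_zero.2 (Fact.out : p.Prime).ne_zero
        rw [norm_mul, norm_zpow, Padic.norm_p, Padic.norm_eq_zpow_neg_valuation u.ne_zero,
          inv_zpow, ← zpow_neg, ← zpow_add₀ hp0]
        simp
      refine ⟨(⟨_, hL (PadicInt.mkUnits hu)⟩, .ofAdd (u : ℚ_[p]).valuation), ?_⟩
      rw [hf]
      have e : Units.map (algebraMap ℤ_[p] ℚ_[p]).toMonoidHom (PadicInt.mkUnits hu) *
          (Units.mk0 (p : ℚ_[p]) hp) ^ (u : ℚ_[p]).valuation = u := by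
        ext
        have : ((Units.map (algebraMap ℤ_[p] ℚ_[p]).toMonoidHom (PadicInt.mkUnits hu) : ℚ_[p]ˣ) :
          ℚ_[p]) = (u : ℚ_[p]) * (p : ℚ_[p]) ^ (-(u : ℚ_[p]).valuation) := rfl
        rw [Units.val_mul, this, Units.val_zpow_eq_zpow_val, Units.val_mk0, mul_assoc,
          ← zpow_add₀ hp]
        simp
      conv_rhs => rw [← e, map_mul, map_zpow]
      congr 1
      exact Matrix.GeneralLinearGroup.map_scalar _ _

theorem range_inclKZ :
    (inclKZ p).range = (inclK p).range ⊔ Subgroup.center (GL (Fin 2) ℚ_[p]) := by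
  have := range_aux (p := p) ⊤ (by simp)
    ((inclKZ p).comp ((⊤ : Subgroup (GL (Fin 2) ℤ_[p])).subtype.prodMap (MonoidHom.id _)))
    (fun x => rfl)
  rw [← MonoidHom.range_eq_map] at this
  rw [← this]
  ext y
  constructor
  · rintro ⟨x, rfl⟩
    exact ⟨(⟨x.1, trivial⟩, x.2), rfl⟩
  · rintro ⟨x, rfl⟩
    exact ⟨(x.1.1, x.2), rfl⟩

theorem range_inclIZ :
    (inclIZ p).range = (iwahori p).map (inclK p) ⊔ Subgroup.center (GL (Fin 2) ℚ_[p]) := by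
  refine range_aux (iwahori p) (fun u => ?_) (inclIZ p) (fun x => rfl)
  show PadicInt.toZMod (Matrix.scalar (Fin 2) (u : ℤ_[p]) 1 0) = 0
  simp

end Groups

/-! ### The representations `V_r` and `d^r` -/

section Weights

variable (p : ℕ) [Fact p.Prime] (k : Type*) [Field k] [Algebra (ZMod p) k]

/-- Reduction mod `p`, as a homomorphism `ℤ_p → 𝔽_p → k`. -/
noncomputable def red : ℤ_[p] →+* k := (algebraMap (ZMod p) k).comp PadicInt.toZMod

variable {k} in
/-- The substitution `v(X, Y) ↦ v(aX + cY, bX + dY)` attached to the matrix `(a b; c d)`, where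
`X` and `Y` are the variables with index `0` and `1`. -/
noncomputable def subst (M : Matrix (Fin 2) (Fin 2) k) :
    MvPolynomial (Fin 2) k →ₐ[k] MvPolynomial (Fin 2) k :=
  MvPolynomial.aeval ![MvPolynomial.C (M 0 0) * MvPolynomial.X 0 +
      MvPolynomial.C (M 1 0) * MvPolynomial.X 1,
    MvPolynomial.C (M 0 1) * MvPolynomial.X 0 + MvPolynomial.C (M 1 1) * MvPolynomial.X 1]

/-- The space `Sym^r k²` of homogeneous polynomials of degree `r` in `X`, `Y` over `k`. -/
def SymPow (r : ℕ) : Type _ := MvPolynomial.homogeneousSubmodule (Fin 2) k r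

noncomputable instance (r : ℕ) : AddCommGroup (SymPow k r) :=
  inferInstanceAs (AddCommGroup (MvPolynomial.homogeneousSubmodule (Fin 2) k r))

noncomputable instance (r : ℕ) : Module k (SymPow k r) :=
  inferInstanceAs (Module k (MvPolynomial.homogeneousSubmodule (Fin 2) k r))

/-- The action of the monoid of all `2 × 2` matrices on `Sym^r k²` by substitution. -/
noncomputable def symAct (r : ℕ) : Representation k (Matrix (Fin 2) (Fin 2) k) (SymPow k r) where
  toFun M := (subst M).toLinearMap.restrict (p := MvPolynomial.homogeneousSubmodule (Fin 2) k r)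
    (q := MvPolynomial.homogeneousSubmodule (Fin 2) k r) fun v hv => by
    have : (subst M v).IsHomogeneous (1 * r) := by
      refine MvPolynomial.IsHomogeneous.aeval hv _ fun i => ?_
      fin_cases i
      · exact (MvPolynomial.isHomogeneous_C_mul_X _ _).add (MvPolynomial.isHomogeneous_C_mul_X _ _)
      · exact (MvPolynomial.isHomogeneous_C_mul_X _ _).add (MvPolynomial.isHomogeneous_C_mul_X _ _)
    rwa [one_mul] at this
  map_one' := by
    have : subst (1 : Matrix (Fin 2) (Fin 2) k) = AlgHom.id k _ := by
      ext i
      fin_cases i <;> simp [subst]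
    refine LinearMap.ext fun v => Subtype.ext ?_
    exact congrArg (fun f : MvPolynomial (Fin 2) k →ₐ[k] MvPolynomial (Fin 2) k => f v.1) this
  map_mul' M N := by
    have : subst (M * N) = (subst M).comp (subst N) := by
      apply MvPolynomial.algHom_ext
      intro i
      fin_cases i <;> simp [subst, Matrix.mul_apply, Fin.sum_univ_two] <;> ring
    refine LinearMap.ext fun v => Subtype.ext ?_
    exact congrArg (fun f : MvPolynomial (Fin 2) k →ₐ[k] MvPolynomial (Fin 2) k => f v.1) this

/-- The representation `V_r` of `KZ`: the group `GL₂(ℤ_p)` acts through reduction mod `p`, and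
`p` acts trivially. -/
noncomputable def weight (r : ℕ) : Representation k (GL (Fin 2) ℤ_[p] × Multiplicative ℤ)
    (SymPow k r) :=
  (symAct k r).comp ((red p k).mapMatrix.toMonoidHom.comp
    ((Units.coeHom _).comp (MonoidHom.fst _ _)))

/-- The representation `d^r` of `IZ` on `k`: a matrix `(a b; c d)` in `I` acts as `d^r mod p`, and
`p` acts trivially. -/
noncomputable def dChar (r : ℕ) : Representation k (iwahori p × Multiplicative ℤ) k where
  toFun x := red p k (x.1.1.1 1 1) ^ r • LinearMap.id
  map_one' := by ext; simp
  map_mul' x y := by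
    have h : red p k (x.1.1.1 1 0) = 0 := by
      rw [red, RingHom.comp_apply, show PadicInt.toZMod (x.1.1.1 1 0) = 0 from x.1.2, map_zero]
    ext
    simp [Matrix.mul_apply, Fin.sum_univ_two, h, mul_pow, mul_comm]

end Weights

/-! ### The matrices and the Hecke operators -/

section Hecke

variable (p : ℕ) [Fact p.Prime]

/-- The Teichmüller representative `[x]` in `ℤ_p` of an element `x` of `𝔽_p`. -/
noncomputable def teich (x : ZMod p) : ℤ_[p] := WittVector.equiv p (WittVector.teichmuller p x)

theorem toZMod_teich (x : ZMod p) : PadicInt.toZMod (teich p x) = x := by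
  set f : ℤ_[p] →+* ZMod p :=
    (WittVector.constantCoeff (p := p)).comp (WittVector.equiv p).symm.toRingHom with hf
  have key : ∀ y, f y = PadicInt.toZMod y := by
    intro y
    have h := PadicInt.toZMod_spec y
    rw [PadicInt.maximalIdeal_eq_span_p, Ideal.mem_span_singleton] at h
    obtain ⟨z, hz⟩ := h
    have h1 : y = (((PadicInt.toZMod y).val : ℕ) : ℤ_[p]) + p * z := by
      rw [← hz, ZMod.natCast_val]; ring
    conv_lhs => rw [h1]
    rw [map_add, map_mul, map_natCast, map_natCast, ZMod.natCast_val, ZMod.cast_id]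
    simp
  rw [← key]
  simp [hf, teich]

variable {p} in
/-- The element of `GL₂(ℚ_p)` given by a matrix over `ℤ_p` with nonzero determinant. -/
noncomputable def toGL (M : Matrix (Fin 2) (Fin 2) ℤ_[p]) (h : M.det ≠ 0) : GL (Fin 2) ℚ_[p] :=
  Matrix.GeneralLinearGroup.mkOfDetNeZero (M.map (algebraMap ℤ_[p] ℚ_[p])) (by
    rw [← RingHom.mapMatrix_apply, ← RingHom.map_det]
    exact fun h0 => h ((map_eq_zero_iff _ (FaithfulSMul.algebraMap_injective _ _)).1 h0))

theorem p_ne_zero : (p : ℤ_[p]) ≠ 0 := Nat.cast_ne_zero.2 (Fact.out : p.Prime).ne_zero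

/-- The matrix `(p [x]; 0 1)`. -/
noncomputable def matSource (x : ZMod p) : GL (Fin 2) ℚ_[p] :=
  toGL !![(p : ℤ_[p]), teich p x; 0, 1] (by simpa [Matrix.det_fin_two_of] using p_ne_zero p)

/-- The matrix `(1 0; p[x] p)`. -/
noncomputable def matSink (x : ZMod p) : GL (Fin 2) ℚ_[p] :=
  toGL !![1, 0; (p : ℤ_[p]) * teich p x, (p : ℤ_[p])]
    (by simpa [Matrix.det_fin_two_of] using p_ne_zero p)

/-- The matrix `α = (1 0; 0 p)`. -/
noncomputable def matAlpha : GL (Fin 2) ℚ_[p] :=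
  toGL !![1, 0; 0, (p : ℤ_[p])] (by simpa [Matrix.det_fin_two_of] using p_ne_zero p)

/-- The matrix `β = (0 1; p 0)`. -/
noncomputable def matBeta : GL (Fin 2) ℚ_[p] :=
  toGL !![0, 1; (p : ℤ_[p]), 0] (by simpa [Matrix.det_fin_two_of] using p_ne_zero p)

variable (k : Type*) [Field k] [Algebra (ZMod p) k] (r : ℕ)

/-- The elementary function `[g, v]` in `ind_{KZ}^G V_r`. -/
noncomputable def elemKZ (g : GL (Fin 2) ℚ_[p])
    (v : SymPow k r) : cIndV (inclKZ p) (weight p k r) :=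
  elem inclKZ_injective (weight p k r) g v

/-- The elementary function `⟦g, v⟧` in `ind_{IZ}^G d^r`. -/
noncomputable def elemIZ (g : GL (Fin 2) ℚ_[p]) (v : k) : cIndV (inclIZ p) (dChar p k r) :=
  elem inclIZ_injective (dChar p k r) g v

/-- The matrices in the formula for `T`: `(p [x]; 0 1)` for `x ∈ 𝔽_p`, and `α`. -/
noncomputable def sphMat : Option (ZMod p) → GL (Fin 2) ℚ_[p]
  | some x => matSource p x
  | none => matAlpha p

/-- The maps in the formula for `T`: `v ↦ v(X, -[x]X + pY)` for `x ∈ 𝔽_p`, and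
`v ↦ v(pX, Y)`. -/
noncomputable def sphAct :
    Option (ZMod p) → Module.End k (SymPow k r)
  | some x => symAct k r ((red p k).mapMatrix !![1, -teich p x; 0, (p : ℤ_[p])])
  | none => symAct k r ((red p k).mapMatrix !![(p : ℤ_[p]), 0; 0, 1])

/-- The spherical Hecke operator `T` on `ind_{KZ}^G V_r`; see `heckeT_elem`. -/
noncomputable def heckeT : Module.End k (cIndV (inclKZ p) (weight p k r)) :=
  heckeOp inclKZ_injective (weight p k r) (sphMat p) (sphAct p k r)

/-- The Iwahori-Hecke operator `T_{-1,0}` on `ind_{IZ}^G d^r`; see `heckeSource_elem`. -/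
noncomputable def heckeSource : Module.End k (cIndV (inclIZ p) (dChar p k r)) :=
  heckeOp inclIZ_injective (dChar p k r) (fun x : ZMod p => matSource p x)
    (fun _ => LinearMap.id)

/-- The Iwahori-Hecke operator `T_{1,2}` on `ind_{IZ}^G d^r`; see `heckeSink_elem`. -/
noncomputable def heckeSink : Module.End k (cIndV (inclIZ p) (dChar p k r)) :=
  heckeOp inclIZ_injective (dChar p k r) (fun x : ZMod p => matSink p x)
    (fun _ => LinearMap.id)

/-- The Iwahori-Hecke operator `T_{1,0}` on `ind_{IZ}^G d^r` for `r = 0` and `r = p - 1`; see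
`heckeFlip_elem`. (It has no meaning for the other values of `r`, for which it is only ever
multiplied by `0`.) -/
noncomputable def heckeFlip : Module.End k (cIndV (inclIZ p) (dChar p k r)) :=
  heckeOp inclIZ_injective (dChar p k r) (fun _ : Unit => matBeta p) (fun _ => LinearMap.id)

variable {p k r}

theorem toZMod_eq_zero {x : ℤ_[p]} (h : PadicInt.toZMod x = 0) : ∃ y, x = p * y := by
  have : x ∈ RingHom.ker (PadicInt.toZMod (p := p)) := h
  rw [PadicInt.ker_toZMod, PadicInt.maximalIdeal_eq_span_p, Ideal.mem_span_singleton] at this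
  exact this

theorem incl_mul_toGL {h h' : GL (Fin 2) ℤ_[p]} {M N : Matrix (Fin 2) (Fin 2) ℤ_[p]}
    (hM : M.det ≠ 0) (hN : N.det ≠ 0) (e : h.1 * M = N * h'.1) (n : Multiplicative ℤ) :
    inclKZ p (h, n) * toGL M hM = toGL N hN * inclKZ p (h', n) := by
  have hc : Commute (pScalar p ^ n.toAdd) (toGL M hM) :=
    (show Commute (pScalar p) _ from pScalar_comm p _).zpow_left _
  have e2 : inclK p h * toGL M hM = toGL N hN * inclK p h' := by
    apply Units.ext
    have := congrArg (fun Q => Q.map (algebraMap ℤ_[p] ℚ_[p])) e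
    rw [Matrix.map_mul, Matrix.map_mul] at this
    exact this
  show inclK p h * pScalar p ^ n.toAdd * toGL M hM =
    toGL N hN * (inclK p h' * pScalar p ^ n.toAdd)
  rw [mul_assoc, hc.eq, ← mul_assoc, e2, mul_assoc]

theorem det_eq {h : GL (Fin 2) ℤ_[p]} {M N M' : Matrix (Fin 2) (Fin 2) ℤ_[p]}
    (hN : N.det ≠ 0) (hd : M.det = N.det) (e : h.1 * M = N * M') : M'.det = h.1.det := by
  have := congrArg Matrix.det e
  rw [Matrix.det_mul, Matrix.det_mul, hd, mul_comm] at this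
  exact (mul_left_cancel₀ hN this).symm

theorem exists_GL {h : GL (Fin 2) ℤ_[p]} {M N M' : Matrix (Fin 2) (Fin 2) ℤ_[p]}
    (hN : N.det ≠ 0) (hd : M.det = N.det) (e : h.1 * M = N * M') :
    ∃ h' : GL (Fin 2) ℤ_[p], h'.1 = M' :=
  ⟨Matrix.GeneralLinearGroup.mk'' M' (by
    rw [det_eq hN hd e]; exact (Matrix.isUnit_iff_isUnit_det _).1 h.isUnit), rfl⟩

theorem adj_aux {h h' : GL (Fin 2) ℤ_[p]} {M N : Matrix (Fin 2) (Fin 2) ℤ_[p]}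
    (hN : N.det ≠ 0) (hd : M.det = N.det) (e : h.1 * M = N * h'.1) :
    h'.1 * M.adjugate = N.adjugate * h.1 := by
  have h1 := det_eq hN hd e
  have h2 : h.1.det ≠ 0 := h.det_ne_zero
  have e2 := congrArg Matrix.adjugate e
  rw [Matrix.adjugate_mul_distrib, Matrix.adjugate_mul_distrib] at e2
  have e3 : h'.1 * (M.adjugate * h.1.adjugate) * h.1 =
      h'.1 * (h'.1.adjugate * N.adjugate) * h.1 := by rw [e2]
  rw [mul_assoc, mul_assoc M.adjugate, Matrix.adjugate_mul, ← mul_assoc h'.1 h'.1.adjugate,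
    Matrix.mul_adjugate, h1, Matrix.mul_smul, Matrix.mul_smul, mul_one, Matrix.smul_mul,
    Matrix.smul_mul, one_mul] at e3
  exact smul_right_injective _ h2 e3

variable (p) in
/-- The matrices occurring in the formula for `T`, over `ℤ_p`. -/
noncomputable def intMat : Option (ZMod p) → Matrix (Fin 2) (Fin 2) ℤ_[p]
  | some x => !![(p : ℤ_[p]), teich p x; 0, 1]
  | none => !![1, 0; 0, (p : ℤ_[p])]

theorem intMat_det (j : Option (ZMod p)) : (intMat p j).det = p := by
  cases j <;> simp [intMat, Matrix.det_fin_two_of]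

theorem toZMod_p : PadicInt.toZMod (p : ℤ_[p]) = 0 := by simp

theorem intMat_exists (h : GL (Fin 2) ℤ_[p]) (j : Option (ZMod p)) :
    ∃ (l : Option (ZMod p)) (h' : GL (Fin 2) ℤ_[p]), h.1 * intMat p j = intMat p l * h'.1 := by
  suffices H : ∃ (l : Option (ZMod p)) (M' : Matrix (Fin 2) (Fin 2) ℤ_[p]),
      h.1 * intMat p j = intMat p l * M' by
    obtain ⟨l, M', e⟩ := H
    obtain ⟨h', rfl⟩ := exists_GL (by rw [intMat_det]; exact p_ne_zero p)
      (by rw [intMat_det, intMat_det]) e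
    exact ⟨l, h', e⟩
  have key : ∀ M : Matrix (Fin 2) (Fin 2) ℤ_[p], PadicInt.toZMod M.det = 0 →
      ∃ (l : Option (ZMod p)) (M' : Matrix (Fin 2) (Fin 2) ℤ_[p]), M = intMat p l * M' := by
    intro M hM
    rw [Matrix.det_fin_two, map_sub, map_mul, map_mul, sub_eq_zero] at hM
    have hs : ∀ x : ZMod p,
        PadicInt.toZMod (M 0 0) = x * PadicInt.toZMod (M 1 0) →
        PadicInt.toZMod (M 0 1) = x * PadicInt.toZMod (M 1 1) →
        ∃ (l : Option (ZMod p)) (M' : Matrix (Fin 2) (Fin 2) ℤ_[p]), M = intMat p l * M' := by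
      intro x h0 h1
      obtain ⟨y, hy⟩ := toZMod_eq_zero (x := M 0 0 - teich p x * M 1 0) (by
        rw [map_sub, map_mul, toZMod_teich, h0, sub_self])
      obtain ⟨z, hz⟩ := toZMod_eq_zero (x := M 0 1 - teich p x * M 1 1) (by
        rw [map_sub, map_mul, toZMod_teich, h1, sub_self])
      refine ⟨some x, !![y, z; M 1 0, M 1 1], ?_⟩
      ext i j
      fin_cases i <;> fin_cases j <;> simp [intMat, Matrix.mul_apply, Fin.sum_univ_two]
      · rw [← hy]; ring
      · rw [← hz]; ring
    by_cases h0 : PadicInt.toZMod (M 1 0) = 0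
    · by_cases h1 : PadicInt.toZMod (M 1 1) = 0
      · obtain ⟨y, hy⟩ := toZMod_eq_zero h0
        obtain ⟨z, hz⟩ := toZMod_eq_zero h1
        refine ⟨none, !![M 0 0, M 0 1; y, z], ?_⟩
        ext i j
        fin_cases i <;> fin_cases j <;> simp [intMat, Matrix.mul_apply, Fin.sum_univ_two, hy, hz]
      · refine hs (PadicInt.toZMod (M 0 1) / PadicInt.toZMod (M 1 1)) ?_ ?_
        · field_simp
          rw [hM]
        · field_simp
    · refine hs (PadicInt.toZMod (M 0 0) / PadicInt.toZMod (M 1 0)) ?_ ?_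
      · field_simp
      · field_simp
        rw [← hM]
  apply key
  rw [Matrix.det_mul, intMat_det, map_mul, toZMod_p, mul_zero]

theorem intMat_unique {j j' : Option (ZMod p)} {u : GL (Fin 2) ℤ_[p]}
    (e : intMat p j * u.1 = intMat p j') : j = j' := by
  have e' : intMat p j' * u⁻¹.1 = intMat p j := by
    rw [← e, mul_assoc, ← Units.val_mul, mul_inv_cancel, Units.val_one, mul_one]
  have aux : ∀ (x : ZMod p) (w : GL (Fin 2) ℤ_[p]), intMat p (some x) * w.1 ≠ intMat p none := by
    intro x w hw
    have h00 := congrFun (congrFun hw 0) 0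
    have h10 := congrFun (congrFun hw 1) 0
    simp [intMat, Matrix.mul_apply, Fin.sum_univ_two] at h00 h10
    have := congrArg PadicInt.toZMod h00
    rw [h10] at this
    simp at this
  cases j with
  | none =>
    cases j' with
    | none => rfl
    | some x => exact absurd e' (aux x _)
  | some x =>
    cases j' with
    | none => exact absurd e (aux x _)
    | some y =>
      have h01 := congrFun (congrFun e 0) 1
      have h11 := congrFun (congrFun e 1) 1
      simp [intMat, Matrix.mul_apply, Fin.sum_univ_two] at h01 h11
      have := congrArg PadicInt.toZMod h01
      rw [h11] at this
      simp [toZMod_teich] at this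
      rw [this]

theorem heckeT_compat (h : GL (Fin 2) ℤ_[p] × Multiplicative ℤ)
    (v : SymPow k r) :
    ∑ j, elem inclKZ_injective (weight p k r) (inclKZ p h * sphMat p j) (sphAct p k r j v) =
    ∑ j, elem inclKZ_injective (weight p k r) (sphMat p j)
      (sphAct p k r j (weight p k r h v)) := by
  have hne : ∀ j, (intMat p j).det ≠ 0 := fun j => by rw [intMat_det]; exact p_ne_zero p
  have hm : sphMat p = fun j => toGL (intMat p j) (hne j) := by
    funext j; cases j <;> rfl
  have hA : sphAct p k r = fun j => symAct k r ((red p k).mapMatrix (intMat p j).adjugate) := by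
    funext j; cases j <;> simp [sphAct, intMat, Matrix.adjugate_fin_two_of]
  refine compat_of_perm inclKZ_injective ?_ h v
  rw [hm, hA]
  rintro ⟨g, n⟩
  choose s g' e using intMat_exists g
  refine ⟨s, fun j => (g' j, n), ?_, fun j => ⟨incl_mul_toGL _ _ (e j) n, fun w => ?_⟩⟩
  · intro j j' hj
    apply intMat_unique (u := (g' j)⁻¹ * g' j')
    have h1 := e j
    have h2 := e j'
    rw [hj] at h1
    have h3 : intMat p (s j') = g.1 * intMat p j * (g' j)⁻¹.1 := by
      rw [h1, mul_assoc, ← Units.val_mul, mul_inv_cancel, Units.val_one, mul_one]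
    rw [h3, mul_assoc, mul_assoc] at h2
    have h4 := congrArg (fun Q => g⁻¹.1 * Q) h2
    rw [← mul_assoc, ← mul_assoc, ← Units.val_mul, inv_mul_cancel, Units.val_one, one_mul,
      one_mul] at h4
    rw [Units.val_mul]
    exact h4.symm
  · have ha := adj_aux (hne _) (by rw [intMat_det, intMat_det]) (e j)
    have hb : weight p k r (g' j, n) * symAct k r ((red p k).mapMatrix (intMat p j).adjugate) =
        symAct k r ((red p k).mapMatrix (intMat p (s j)).adjugate) * weight p k r (g, n) := by
      show symAct k r ((red p k).mapMatrix (g' j).1) * _ =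
        _ * symAct k r ((red p k).mapMatrix g.1)
      rw [← map_mul, ← map_mul, ← map_mul, ← map_mul, ha]
    exact LinearMap.congr_fun hb w

/-- The formula defining `T`:
`T [g, v] = ∑_{x ∈ 𝔽_p} [g (p [x]; 0 1), v(X, -[x]X + pY)] + [g α, v(pX, Y)]`. -/
theorem heckeT_elem (g : GL (Fin 2) ℚ_[p]) (v : SymPow k r) :
    heckeT p k r (elemKZ p k r g v) =
      ∑ x : ZMod p, elemKZ p k r (g * matSource p x)
        (symAct k r ((red p k).mapMatrix !![1, -teich p x; 0, (p : ℤ_[p])]) v) +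
      elemKZ p k r (g * matAlpha p) (symAct k r ((red p k).mapMatrix !![(p : ℤ_[p]), 0; 0, 1]) v) :=
  by
  refine (heckeOp_elem inclKZ_injective heckeT_compat g v).trans ?_
  rw [Fintype.sum_option, add_comm]
  rfl

theorem heckeT_comm (g : GL (Fin 2) ℚ_[p]) (f : cIndV (inclKZ p) (weight p k r)) :
    heckeT p k r (cInd _ _ g f) = cInd _ _ g (heckeT p k r f) :=
  heckeOp_comm inclKZ_injective heckeT_compat g f

/-- The compatibility for the operators on `ind_{IZ}^G d^r`, given by a family of matrices `M j`
over `ℤ_p` of the same determinant. -/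
theorem iwahori_compat {J : Type*} [Fintype J] (M : J → Matrix (Fin 2) (Fin 2) ℤ_[p])
    (hne : ∀ j, (M j).det ≠ 0) (hd : ∀ i j, (M i).det = (M j).det)
    (hex : ∀ g ∈ iwahori p, ∃ s : J → J, Function.Injective s ∧ ∀ j,
      ∃ M' : Matrix (Fin 2) (Fin 2) ℤ_[p], g.1 * M j = M (s j) * M' ∧
        PadicInt.toZMod (M' 1 0) = 0 ∧ red p k (M' 1 1) ^ r = red p k (g.1 1 1) ^ r)
    (h : iwahori p × Multiplicative ℤ) (v : k) :
    ∑ j, elem inclIZ_injective (dChar p k r) (inclIZ p h * toGL (M j) (hne j))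
      ((LinearMap.id : k →ₗ[k] k) v) =
    ∑ j, elem inclIZ_injective (dChar p k r) (toGL (M j) (hne j))
      ((LinearMap.id : k →ₗ[k] k) (dChar p k r h v)) := by
  refine compat_of_perm (m := fun j => toGL (M j) (hne j)) (A := fun _ => LinearMap.id)
    inclIZ_injective ?_ h v
  rintro ⟨⟨g, hg⟩, n⟩
  obtain ⟨s, hs, hj⟩ := hex g hg
  choose M' e h0 hr using hj
  have := fun j => exists_GL (hne _) (hd j (s j)) (e j)
  choose g' hg' using this
  refine ⟨s, fun j => (⟨g' j, ?_⟩, n), hs, fun j => ⟨?_, fun w => ?_⟩⟩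
  · show PadicInt.toZMod ((g' j).1 1 0) = 0
    rw [hg', h0]
  · have e1 : g.1 * M j = M (s j) * (g' j).1 := by rw [hg', e]
    exact incl_mul_toGL (hne j) (hne (s j)) e1 n
  · show red p k ((g' j).1 1 1) ^ r • w = red p k (g.1 1 1) ^ r • w
    rw [hg', hr]

theorem iwahori_diag {g : GL (Fin 2) ℤ_[p]} (hg : g ∈ iwahori p) :
    PadicInt.toZMod (g.1 0 0) ≠ 0 ∧ PadicInt.toZMod (g.1 1 1) ≠ 0 := by
  have h : IsUnit (PadicInt.toZMod g.1.det) :=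
    ((Matrix.isUnit_iff_isUnit_det _).1 g.isUnit).map _
  have h0 : PadicInt.toZMod (g.1 1 0) = 0 := hg
  rw [Matrix.det_fin_two, map_sub, map_mul, map_mul, h0, mul_zero, sub_zero] at h
  exact ⟨left_ne_zero_of_mul h.ne_zero, right_ne_zero_of_mul h.ne_zero⟩

theorem heckeSource_compat (h : iwahori p × Multiplicative ℤ) (v : k) :
    ∑ x : ZMod p, elem inclIZ_injective (dChar p k r) (inclIZ p h * matSource p x)
      ((LinearMap.id : k →ₗ[k] k) v) =
    ∑ x : ZMod p, elem inclIZ_injective (dChar p k r) (matSource p x)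
      ((LinearMap.id : k →ₗ[k] k) (dChar p k r h v)) := by
  refine iwahori_compat (fun x : ZMod p => !![(p : ℤ_[p]), teich p x; 0, 1]) _
    (by simp [Matrix.det_fin_two_of]) ?_ h v
  intro g hg
  obtain ⟨ha, hd⟩ := iwahori_diag hg
  obtain ⟨c, hc⟩ := toZMod_eq_zero (show PadicInt.toZMod (g.1 1 0) = 0 from hg)
  refine ⟨fun x => (PadicInt.toZMod (g.1 0 0) * x + PadicInt.toZMod (g.1 0 1)) /
    PadicInt.toZMod (g.1 1 1), ?_, fun x => ?_⟩
  · intro x y hxy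
    simpa [div_left_inj' hd, ha] using hxy
  · set y := (PadicInt.toZMod (g.1 0 0) * x + PadicInt.toZMod (g.1 0 1)) /
      PadicInt.toZMod (g.1 1 1) with hy
    obtain ⟨z, hz⟩ := toZMod_eq_zero
      (x := g.1 0 0 * teich p x + g.1 0 1 - teich p y * (g.1 1 0 * teich p x + g.1 1 1)) (by
        rw [hc]
        simp only [map_sub, map_add, map_mul, toZMod_teich, toZMod_p, hy]
        field_simp
        simp)
    refine ⟨!![g.1 0 0 - teich p y * g.1 1 0 + 0, z; p * g.1 1 0, g.1 1 0 * teich p x + g.1 1 1],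
      ?_, by simp, ?_⟩
    · ext i j
      fin_cases i <;> fin_cases j <;> simp [Matrix.mul_apply, Fin.sum_univ_two]
      · ring
      · rw [← hz]; ring
      · ring
    · have : red p k (g.1 1 0) = 0 := by
        rw [red, RingHom.comp_apply, show PadicInt.toZMod (g.1 1 0) = 0 from hg, map_zero]
      simp [this]

theorem heckeSink_compat (h : iwahori p × Multiplicative ℤ) (v : k) :
    ∑ x : ZMod p, elem inclIZ_injective (dChar p k r) (inclIZ p h * matSink p x)
      ((LinearMap.id : k →ₗ[k] k) v) =
    ∑ x : ZMod p, elem inclIZ_injective (dChar p k r) (matSink p x)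
      ((LinearMap.id : k →ₗ[k] k) (dChar p k r h v)) := by
  refine iwahori_compat (fun x : ZMod p => !![1, 0; (p : ℤ_[p]) * teich p x, (p : ℤ_[p])]) _
    (by simp [Matrix.det_fin_two_of]) ?_ h v
  intro g hg
  obtain ⟨ha, hd⟩ := iwahori_diag hg
  obtain ⟨c, hc⟩ := toZMod_eq_zero (show PadicInt.toZMod (g.1 1 0) = 0 from hg)
  refine ⟨fun x => (PadicInt.toZMod (g.1 1 1) * x + PadicInt.toZMod c) /
    PadicInt.toZMod (g.1 0 0), ?_, fun x => ?_⟩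
  · intro x y hxy
    simpa [div_left_inj' ha, hd] using hxy
  · set y := (PadicInt.toZMod (g.1 1 1) * x + PadicInt.toZMod c) /
      PadicInt.toZMod (g.1 0 0) with hy
    obtain ⟨z, hz⟩ := toZMod_eq_zero
      (x := c + g.1 1 1 * teich p x - teich p y * (g.1 0 0 + g.1 0 1 * ((p : ℤ_[p]) * teich p x))) (by
        simp only [map_sub, map_add, map_mul, toZMod_teich, toZMod_p, hy]
        field_simp
        simp [add_comm])
    refine ⟨!![g.1 0 0 + g.1 0 1 * ((p : ℤ_[p]) * teich p x), g.1 0 1 * p;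
      p * z, g.1 1 1 - teich p y * (g.1 0 1 * p)], ?_, by simp, ?_⟩
    · ext i j
      fin_cases i <;> fin_cases j <;> simp [Matrix.mul_apply, Fin.sum_univ_two]
      · rw [← hz, hc]; ring
      · ring
    · have : red p k (p : ℤ_[p]) = 0 := by
        rw [red, RingHom.comp_apply, toZMod_p, map_zero]
      rw [map_natCast] at this
      simp [this]

theorem heckeFlip_compat (hr : r = 0 ∨ r = p - 1) (h : iwahori p × Multiplicative ℤ) (v : k) :
    ∑ _x : Unit, elem inclIZ_injective (dChar p k r) (inclIZ p h * matBeta p)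
      ((LinearMap.id : k →ₗ[k] k) v) =
    ∑ _x : Unit, elem inclIZ_injective (dChar p k r) (matBeta p)
      ((LinearMap.id : k →ₗ[k] k) (dChar p k r h v)) := by
  refine iwahori_compat (fun x : Unit => !![0, 1; (p : ℤ_[p]), 0]) _
    (by simp [Matrix.det_fin_two_of]) ?_ h v
  intro g hg
  obtain ⟨ha, hd⟩ := iwahori_diag hg
  obtain ⟨c, hc⟩ := toZMod_eq_zero (show PadicInt.toZMod (g.1 1 0) = 0 from hg)
  refine ⟨id, Function.injective_id, fun _ => ⟨!![g.1 1 1, c; p * g.1 0 1, g.1 0 0], ?_, by simp,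
    ?_⟩⟩
  · ext i j
    fin_cases i <;> fin_cases j <;> simp [Matrix.mul_apply, Fin.sum_univ_two, hc, mul_comm]
  · rcases hr with rfl | rfl
    · simp
    · have h1 : ∀ x : ℤ_[p], PadicInt.toZMod x ≠ 0 → red p k x ^ (p - 1) = 1 := by
        intro x hx
        rw [red, RingHom.comp_apply, ← map_pow, ZMod.pow_card_sub_one_eq_one hx, map_one]
      show red p k (g.1 0 0) ^ (p - 1) = red p k (g.1 1 1) ^ (p - 1)
      rw [h1 _ ha, h1 _ hd]

/-- The formula defining `T_{-1,0}`: `T_{-1,0} ⟦g, v⟧ = ∑_{x ∈ 𝔽_p} ⟦g (p [x]; 0 1), v⟧`. -/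
theorem heckeSource_elem (g : GL (Fin 2) ℚ_[p]) (v : k) :
    heckeSource p k r (elemIZ p k r g v) = ∑ x : ZMod p, elemIZ p k r (g * matSource p x) v :=
  heckeOp_elem inclIZ_injective heckeSource_compat g v

theorem heckeSource_comm (g : GL (Fin 2) ℚ_[p]) (f : cIndV (inclIZ p) (dChar p k r)) :
    heckeSource p k r (cInd _ _ g f) = cInd _ _ g (heckeSource p k r f) :=
  heckeOp_comm inclIZ_injective heckeSource_compat g f

/-- The formula defining `T_{1,2}`: `T_{1,2} ⟦g, v⟧ = ∑_{x ∈ 𝔽_p} ⟦g (1 0; p[x] p), v⟧`. -/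
theorem heckeSink_elem (g : GL (Fin 2) ℚ_[p]) (v : k) :
    heckeSink p k r (elemIZ p k r g v) = ∑ x : ZMod p, elemIZ p k r (g * matSink p x) v :=
  heckeOp_elem inclIZ_injective heckeSink_compat g v

theorem heckeSink_comm (g : GL (Fin 2) ℚ_[p]) (f : cIndV (inclIZ p) (dChar p k r)) :
    heckeSink p k r (cInd _ _ g f) = cInd _ _ g (heckeSink p k r f) :=
  heckeOp_comm inclIZ_injective heckeSink_compat g f

/-- The formula defining `T_{1,0}`: `T_{1,0} ⟦g, v⟧ = ⟦g β, v⟧`. -/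
theorem heckeFlip_elem (hr : r = 0 ∨ r = p - 1) (g : GL (Fin 2) ℚ_[p]) (v : k) :
    heckeFlip p k r (elemIZ p k r g v) = elemIZ p k r (g * matBeta p) v :=
  (heckeOp_elem inclIZ_injective (heckeFlip_compat hr) g v).trans (by simp [elemIZ])

theorem heckeFlip_comm (hr : r = 0 ∨ r = p - 1) (g : GL (Fin 2) ℚ_[p])
    (f : cIndV (inclIZ p) (dChar p k r)) :
    heckeFlip p k r (cInd _ _ g f) = cInd _ _ g (heckeFlip p k r f) :=
  heckeOp_comm inclIZ_injective (heckeFlip_compat hr) g f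

end Hecke

/-! ### The two definitions of `π(r, λ, η)` -/

section Pi

variable (p : ℕ) [Fact p.Prime] (k : Type*) [Field k] [Algebra (ZMod p) k] (r : ℕ) (lam : k)

/-- The image of `T - λ` on `ind_{KZ}^G V_r`. -/
noncomputable def sphericalRel : Submodule k (cIndV (inclKZ p) (weight p k r)) :=
  LinearMap.range (heckeT p k r - algebraMap k (Module.End k _) lam)

theorem sphericalRel_stable (g : GL (Fin 2) ℚ_[p]) :
    sphericalRel p k r lam ≤ (sphericalRel p k r lam).comap (cInd _ _ g) := by
  rintro _ ⟨f, rfl⟩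
  exact ⟨cInd _ _ g f, by simp [heckeT_comm]⟩

/-- The spherical definition: `π(r, λ, η) = ind_{KZ}^G V_r / (T - λ) ⊗ (η ∘ det)`. -/
noncomputable def sphericalPi (η : ℚ_[p]ˣ →* kˣ) : Representation k (GL (Fin 2) ℚ_[p])
    (cIndV (inclKZ p) (weight p k r) ⧸ sphericalRel p k r lam) :=
  twist ((cInd (inclKZ p) (weight p k r)).quotient (sphericalRel p k r lam)
    (sphericalRel_stable p k r lam)) (η.comp Matrix.GeneralLinearGroup.det)

/-- The sum of the images of `T_{-1,0} + δ_{r,p-1} T_{1,0}` and `T_{1,2} + δ_{r,0} T_{1,0} - λ` on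
`ind_{IZ}^G d^r`. -/
noncomputable def iwahoriRel : Submodule k (cIndV (inclIZ p) (dChar p k r)) :=
  LinearMap.range (heckeSource p k r + (if r = p - 1 then (1 : k) else 0) • heckeFlip p k r) ⊔
  LinearMap.range (heckeSink p k r + (if r = 0 then (1 : k) else 0) • heckeFlip p k r -
    algebraMap k (Module.End k _) lam)

theorem iwahoriRel_stable (g : GL (Fin 2) ℚ_[p]) :
    iwahoriRel p k r lam ≤ (iwahoriRel p k r lam).comap (cInd _ _ g) := by
  refine sup_le ?_ ?_
  · rintro _ ⟨f, rfl⟩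
    refine Submodule.mem_sup_left ⟨cInd _ _ g f, ?_⟩
    split_ifs with h <;> simp [heckeSource_comm, heckeFlip_comm, h]
  · rintro _ ⟨f, rfl⟩
    refine Submodule.mem_sup_right ⟨cInd _ _ g f, ?_⟩
    split_ifs with h <;> simp [heckeSink_comm, heckeFlip_comm, h]

/-- The Iwahori definition: `π(r, λ, η)` is the quotient of `ind_{IZ}^G d^r` by
`(T_{-1,0} + δ_{r,p-1} T_{1,0}) + (T_{1,2} + δ_{r,0} T_{1,0} - λ)`, twisted by `η ∘ det`. -/
noncomputable def iwahoriPi (η : ℚ_[p]ˣ →* kˣ) : Representation k (GL (Fin 2) ℚ_[p])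
    (cIndV (inclIZ p) (dChar p k r) ⧸ iwahoriRel p k r lam) :=
  twist ((cInd (inclIZ p) (dChar p k r)).quotient (iwahoriRel p k r lam)
    (iwahoriRel_stable p k r lam)) (η.comp Matrix.GeneralLinearGroup.det)

end Pi
end ABC

namespace ABC

/-! ### Frobenius reciprocity for compact induction -/

section Lift

variable {k G H V W : Type*} [CommRing k] [Group G] [Group H] [AddCommGroup V] [Module k V]
  [AddCommGroup W] [Module k W] {ι : H →* G} {ρ : Representation k H V}

/-! The line spanned by `X ^ r` in `V_r` is stable under `I`, with character `a ^ r`. Conjugation by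
`β` preserves `I` and exchanges `a` and `d`, so Frobenius reciprocity turns the vector `[β, X ^ r]`
into a `G`-map `comparison` from `ind_{IZ}^G d^r` to `ind_{KZ}^G V_r`. The proof shows that the
preimage of the spherical relations under this map is the space of Iwahori relations.

The matrices `(p [x]; 0 1)` and `β` represent the cosets of `IZ` in `KβIZ`, a copy of `ℙ¹(𝔽_p)`; the
map sends the corresponding elementary functions to `[1, (xX + Y) ^ r]` and `[1, X ^ r]`. These
powers span `V_r` because `r < p`, whence surjectivity (`comparison_surjective`). By a short matrix
computation the map carries `T_{1,2} + δ_{r,0} T_{1,0}` to `T` (`comparison_comp_sinkOp`).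

The main point is that the kernel equals the image `A` of `T_{-1,0} + δ_{r,p-1} T_{1,0}`. That `A`
is killed is a power sum identity (`sum_symPower`). Conversely, modulo `A` the translates of the
generator `e_z`, `e_∞` satisfy `∑ (z - y) ^ (p - 1 - r) e_z + e_∞ = 0` for every `y`
(`sourceOp_kappa`). These relations kill the moments `∑ z ^ j e_z` for `j < p - 1 - r`, so by
interpolation `e_z` is a polynomial in `z` of degree at most `r`. Hence `(zX + Y) ^ r ↦ e_z`, `X ^ r
↦ e_∞` is a well-defined linear map on `V_r` (`exists_symPower_lift`). It is `KZ`-equivariant, and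
the `G`-map it induces, composed with `comparison`, is the projection modulo `A`. -/

theorem finite_support_elem (hι : Function.Injective ι) (f : cIndV ι ρ) :
    (Function.support fun c : G ⧸ ι.range => elem hι ρ c.out (f.1 (c.out)⁻¹)).Finite :=
  (finite_support f).subset fun c hc h0 => hc (by simp [h0, elem_zero])

/-- The linear map `v ↦ [g, v]`. -/
noncomputable def elemMap (hι : Function.Injective ι) (ρ : Representation k H V) (g : G) :
    V →ₗ[k] cIndV ι ρ where
  toFun := elem hι ρ g
  map_add' := elem_add hι g
  map_smul' := elem_smul hι g

/-- Linear maps on the compact induction are determined by the elementary functions. -/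
theorem cIndV_hom_ext (hι : Function.Injective ι) {L L' : cIndV ι ρ →ₗ[k] W}
    (h : ∀ g v, L (elem hι ρ g v) = L' (elem hι ρ g v)) : L = L' := by
  ext f
  have key (L : cIndV ι ρ →ₗ[k] W) : L f =
      ∑ᶠ c : G ⧸ ι.range, L (elem hι ρ c.out (f.1 (c.out)⁻¹)) := by
    conv_lhs => rw [eq_finsum hι f]
    exact L.toAddMonoidHom.map_finsum (finite_support_elem hι f)
  rw [key L, key L']
  exact finsum_congr fun c => h _ _

/-- A submodule containing all elementary functions is everything. -/
theorem cIndV_submodule_eq_top (hι : Function.Injective ι) {N : Submodule k (cIndV ι ρ)}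
    (h : ∀ g v, elem hι ρ g v ∈ N) : N = ⊤ := by
  rw [← N.ker_mkQ, LinearMap.ker_eq_top]
  exact cIndV_hom_ext hι fun g v => by simpa using h g v

/-- The linear map on the compact induction which sends `[g, v]` to `g • φ v`, for `φ` an
`H`-equivariant map; see `cIndLift_elem`. -/
noncomputable def cIndLift (ι : H →* G) (ρ : Representation k H V) (σ : Representation k G W)
    (φ : V →ₗ[k] W) : cIndV ι ρ →ₗ[k] W where
  toFun f := ∑ᶠ c : G ⧸ ι.range, σ c.out (φ (f.1 (c.out)⁻¹))
  map_add' f f' := by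
    rw [← finsum_add_distrib]
    · exact finsum_congr fun c => by simp
    · exact (finite_support f).subset fun c hc h0 => hc (by simp [h0])
    · exact (finite_support f').subset fun c hc h0 => hc (by simp [h0])
  map_smul' a f := by
    rw [RingHom.id_apply, smul_finsum' a]
    · exact finsum_congr fun c => by simp
    · exact (finite_support f).subset fun c hc h0 => hc (by simp [h0])

variable {σ : Representation k G W} {φ : V →ₗ[k] W}

/-- Only the coset of `g` contributes to the sum, and the equivariance of `φ` makes its term
independent of the chosen representative. -/
theorem cIndLift_elem (hι : Function.Injective ι) (hφ : ∀ h v, φ (ρ h v) = σ (ι h) (φ v))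
    (g : G) (v : V) : cIndLift ι ρ σ φ (elem hι ρ g v) = σ g (φ v) := by
  have key : cIndLift ι ρ σ φ (elem hι ρ g v) = ∑ᶠ c : G ⧸ ι.range,
    σ c.out (φ ((elem hι ρ g v).1 (c.out)⁻¹)) := rfl
  rw [key, finsum_eq_single _ (g : G ⧸ ι.range)]
  · obtain ⟨⟨_, h, rfl⟩, e⟩ := QuotientGroup.mk_out_eq_mul ι.range g
    simp only at e
    have e2 : (elem hι ρ g v).1 ((g : G ⧸ ι.range).out)⁻¹ = ρ h⁻¹ v :=
      elemFun_of_eq hι (by rw [e]; simp) v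
    rw [e2, e, hφ, ← Module.End.mul_apply, ← map_mul]
    simp
  · intro c hcg
    have : (elem hι ρ g v).1 (c.out)⁻¹ = 0 := by
      apply elemFun_of_not
      rintro ⟨y, hy⟩
      apply hcg
      rw [← QuotientGroup.out_eq' c]
      exact QuotientGroup.eq.2 ⟨y, hy⟩
    simp [this]

theorem cIndLift_equivariant (hι : Function.Injective ι)
    (hφ : ∀ h v, φ (ρ h v) = σ (ι h) (φ v)) (g : G) (f : cIndV ι ρ) :
    cIndLift ι ρ σ φ (cInd ι ρ g f) = σ g (cIndLift ι ρ σ φ f) := by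
  have : cIndLift ι ρ σ φ ∘ₗ cInd ι ρ g = σ g ∘ₗ cIndLift ι ρ σ φ :=
    cIndV_hom_ext hι fun x v => by simp [cInd_elem, cIndLift_elem hι hφ]
  exact LinearMap.congr_fun this f

end Lift

/-! ### Power sums over `𝔽_p` -/

section PowerSums

variable {p : ℕ} [Fact p.Prime] {k M : Type*} [Field k] [Algebra (ZMod p) k]
  [AddCommGroup M] [Module k M]

/-- Exponents above `p - 1` reduce modulo `p - 1` to a positive exponent below `p - 1`. For `s = 0`
the convention `0 ^ 0 = 1` gives the sum `p = 0`. The bound is sharp: at `2 * (p - 1)` the sum is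
`-1` again. -/
theorem sum_pow_eq_zero {s : ℕ} (hs : s < 2 * (p - 1)) (hs' : s ≠ p - 1) :
    ∑ x : ZMod p, algebraMap (ZMod p) k x ^ s = 0 := by
  have h0 : ∀ i < p - 1, ∑ x : ZMod p, x ^ i = 0 := fun i hi =>
    FiniteField.sum_pow_lt_card_sub_one (ZMod p) i (by rwa [ZMod.card])
  simp_rw [← map_pow]
  rw [← map_sum]
  rcases lt_or_ge s (p - 1) with h | h
  · rw [h0 s h, map_zero]
  · obtain ⟨j, rfl⟩ := Nat.exists_eq_add_of_le h
    have hj : ∑ x : ZMod p, x ^ (p - 1 + j) = ∑ x : ZMod p, x ^ j := by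
      refine Finset.sum_congr rfl fun x _ => ?_
      by_cases hx : x = 0
      · rw [hx, zero_pow (by omega), zero_pow (by omega)]
      · rw [pow_add, ZMod.pow_card_sub_one_eq_one hx, one_mul]
    rw [hj, h0 j (by omega), map_zero]

theorem algebraMap_pow_card_sub_one (x : ZMod p) :
    algebraMap (ZMod p) k x ^ (p - 1) = 1 - if x = 0 then 1 else 0 := by
  have := (Fact.out : p.Prime).two_le
  split_ifs with hx
  · rw [hx, map_zero, zero_pow (by omega), sub_self]
  · rw [← map_pow, ZMod.pow_card_sub_one_eq_one hx, map_one, sub_zero]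

theorem sum_pow_card_sub_one : ∑ x : ZMod p, algebraMap (ZMod p) k x ^ (p - 1) = -1 := by
  simp_rw [algebraMap_pow_card_sub_one, Finset.sum_sub_distrib]
  have := congrArg (algebraMap (ZMod p) k) (CharP.cast_eq_zero (ZMod p) p)
  rw [map_natCast, map_zero] at this
  simp [ZMod.card, this]

/-- For `x ≠ z` the sum is `(z ^ p - x ^ p) / (z - x)`, which is `1` by Fermat; for `x = z` it is `p
* x ^ (p - 1) = 0`. -/
theorem sum_pow_mul_pow (x z : ZMod p) :
    ∑ i ∈ Finset.range p, z ^ i * x ^ (p - 1 - i) = 1 - if x = z then 1 else 0 := by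
  split_ifs with h
  · subst h
    have : ∀ i ∈ Finset.range p, x ^ i * x ^ (p - 1 - i) = x ^ (p - 1) := by
      intro i hi
      rw [← pow_add]
      congr 1
      have := Finset.mem_range.1 hi
      omega
    rw [Finset.sum_congr rfl this]
    simp
  · have h1 := (Commute.all z x).geom_sum₂_mul p
    rw [ZMod.pow_card, ZMod.pow_card] at h1
    rw [sub_zero]
    exact mul_right_cancel₀ (sub_ne_zero.2 (Ne.symm h)) (by rw [h1, one_mul])

/-- Lagrange interpolation on `𝔽_p`: each `e z` in terms of the moments of the family `e`. -/
theorem eq_sub_sum_moments (e : ZMod p → M) (z : ZMod p) :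
    e z = e 0 - ∑ i ∈ Finset.range (p - 1), algebraMap (ZMod p) k z ^ (i + 1) •
      ∑ x, algebraMap (ZMod p) k x ^ (p - 1 - (i + 1)) • e x := by
  have hp : Finset.range p = Finset.range (p - 1 + 1) := by
    rw [Nat.sub_add_cancel (Fact.out : p.Prime).one_le]
  have h1 : ∀ x : ZMod p, ∑ i ∈ Finset.range (p - 1), algebraMap (ZMod p) k z ^ (i + 1) *
      algebraMap (ZMod p) k x ^ (p - 1 - (i + 1)) =
      (if x = 0 then 1 else 0) - if x = z then 1 else 0 := by
    intro x
    have a := sum_pow_mul_pow x z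
    -- For both `z` and `0` the term of index `0` is `x ^ (p - 1)`; subtracting the two identities
    -- removes it and leaves a difference of two indicator functions.
    have b := sum_pow_mul_pow x 0
    rw [hp, Finset.sum_range_succ'] at a b
    simp only [ne_eq, Nat.add_eq_zero_iff, one_ne_zero, and_false,
      not_false_eq_true, zero_pow, zero_mul, Finset.sum_const_zero, zero_add, pow_zero] at a b
    rw [b] at a
    have := congrArg (algebraMap (ZMod p) k) (eq_sub_of_add_eq a)
    simp only [map_sum, map_mul, map_pow, map_sub] at this
    rw [this]
    split_ifs <;> simp
  simp_rw [Finset.smul_sum, smul_smul]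
  rw [Finset.sum_comm]
  simp_rw [← Finset.sum_smul, h1, sub_smul, Finset.sum_sub_distrib]
  simp

variable (k) in
-- The binomial coefficient divides `n!`, which is prime to `p`.
theorem natCast_choose_ne_zero {n i : ℕ} (hn : n < p) (hi : i ≤ n) :
    (n.choose i : k) ≠ 0 := by
  rw [← map_natCast (algebraMap (ZMod p) k), Ne, map_eq_zero, CharP.cast_eq_zero_iff (ZMod p) p]
  intro hd
  have := hd.trans ⟨_, ((Nat.choose_mul_factorial_mul_factorial hi).symm.trans (mul_assoc _ _ _))⟩
  rw [(Fact.out : p.Prime).dvd_factorial] at this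
  omega

/-- If a family indexed by `ℙ¹(𝔽_p)` satisfies `∑ (z - y) ^ n e_z + e_∞ = 0` for all `y`, then its
moments of degree less than `n` vanish. -/
theorem moment_eq_zero {n : ℕ} (hn : n ≤ p - 1) {e : ZMod p → M} {e' : M}
    (hw : ∀ y, ∑ z, algebraMap (ZMod p) k (z - y) ^ n • e z + e' = 0) {j : ℕ} (hj : j < n) :
    ∑ z, algebraMap (ZMod p) k z ^ j • e z = 0 := by
  set f := algebraMap (ZMod p) k
  set m : ℕ → M := fun i => ∑ z, f z ^ i • e z with hm
  have h1 : ∀ y, ∑ z, f (z - y) ^ n • e z =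
      ∑ i ∈ Finset.range (n + 1), (f y ^ (n - i) * ((-1) ^ (n - i) * n.choose i)) • m i := by
    intro y
    simp_rw [hm, Finset.smul_sum, smul_smul]
    rw [Finset.sum_comm]
    refine Finset.sum_congr rfl fun z _ => ?_
    rw [map_sub, sub_eq_add_neg, add_pow, Finset.sum_smul]
    refine Finset.sum_congr rfl fun i _ => ?_
    rw [neg_pow]
    congr 1
    ring
  -- The relation is a polynomial in `y` whose coefficients are multiples of the moments. Weighting
  -- by this power of `y` and summing gives total exponent `p - 1 + j - i` on the moment `m i`, so
  -- only `i = j` survives. The term `e'` gets an exponent below `p - 1` and drops out.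
  have h2 : ∑ y, f y ^ (p - 1 - (n - j)) • (∑ z, f (z - y) ^ n • e z + e') = 0 :=
    Finset.sum_eq_zero fun y _ => by rw [hw, smul_zero]
  simp_rw [smul_add, Finset.sum_add_distrib, h1, Finset.smul_sum, smul_smul, ← mul_assoc,
    ← pow_add] at h2
  rw [← Finset.sum_smul, sum_pow_eq_zero (by omega) (by omega), zero_smul, add_zero,
    Finset.sum_comm, Finset.sum_eq_single j] at h2
  · simp_rw [mul_assoc] at h2
    rw [← Finset.sum_smul, ← Finset.sum_mul, Nat.sub_add_cancel (by omega),
      sum_pow_card_sub_one, smul_eq_zero] at h2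
    refine h2.resolve_left ?_
    have hc := natCast_choose_ne_zero (k := k) (show n < p by omega) hj.le
    simp [hc]
  · intro i hi hij
    have := Finset.mem_range.1 hi
    simp_rw [mul_assoc]
    rw [← Finset.sum_smul, ← Finset.sum_mul, sum_pow_eq_zero (by omega) (by omega), zero_mul,
      zero_smul]
  · intro h
    exact absurd (Finset.mem_range.2 (by omega)) h

end PowerSums

/-! ### Powers of linear forms in `Sym^r k²` -/

section SymPow

variable {p : ℕ} [Fact p.Prime] {k M : Type*} [Field k] [Algebra (ZMod p) k]
  [AddCommGroup M] [Module k M] {r : ℕ}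

/-- The exponent of the monomial `X ^ i * Y ^ j`. -/
noncomputable def expo (i j : ℕ) : Fin 2 →₀ ℕ := Finsupp.single 0 i + Finsupp.single 1 j

theorem expo_inj {i j i' j' : ℕ} : expo i j = expo i' j' ↔ i = i' ∧ j = j' := by
  refine ⟨fun h => ⟨?_, ?_⟩, fun h => by rw [h.1, h.2]⟩
  · simpa [expo] using DFunLike.congr_fun h 0
  · simpa [expo] using DFunLike.congr_fun h 1

theorem eq_expo (d : Fin 2 →₀ ℕ) : d = expo (d 0) (d 1) := by
  ext i
  fin_cases i <;> simp [expo]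

theorem X_pow_mul_X_pow (i j : ℕ) : (MvPolynomial.X 0 ^ i * MvPolynomial.X 1 ^ j :
    MvPolynomial (Fin 2) k) = MvPolynomial.monomial (expo i j) 1 := by
  rw [MvPolynomial.X_pow_eq_monomial, MvPolynomial.X_pow_eq_monomial, MvPolynomial.monomial_mul,
    one_mul, expo]

/-- The monomial `X ^ i * Y ^ (r - i)` in `Sym^r k²`. -/
noncomputable def symMonomial (k : Type*) [Field k] (r : ℕ) (i : Fin (r + 1)) : SymPow k r :=
  ⟨MvPolynomial.X 0 ^ (i : ℕ) * MvPolynomial.X 1 ^ (r - i), by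
    have := ((MvPolynomial.isHomogeneous_X_pow (R := k) (0 : Fin 2) (i : ℕ)).mul
      (MvPolynomial.isHomogeneous_X_pow (R := k) (1 : Fin 2) (r - i)))
    rwa [Nat.add_sub_cancel' (Nat.le_of_lt_succ i.2)] at this⟩

/-- The coefficient of `X ^ i * Y ^ (r - i)`. -/
noncomputable def symCoeff (k : Type*) [Field k] (r : ℕ) (i : ℕ) : SymPow k r →ₗ[k] k :=
  MvPolynomial.lcoeff k (expo i (r - i)) ∘ₗ
    (MvPolynomial.homogeneousSubmodule (Fin 2) k r).subtype

theorem symCoeff_apply (i : ℕ) (v : SymPow k r) :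
    symCoeff k r i v = MvPolynomial.coeff (expo i (r - i)) v.1 := rfl

/-- The power `(uX + wY) ^ r` of a linear form. -/
noncomputable def symPower {k : Type*} [Field k] (r : ℕ) (u w : k) : SymPow k r :=
  ⟨(MvPolynomial.C u * MvPolynomial.X 0 + MvPolynomial.C w * MvPolynomial.X 1) ^ r, by
    have := ((MvPolynomial.isHomogeneous_C_mul_X u (0 : Fin 2)).add
      (MvPolynomial.isHomogeneous_C_mul_X w (1 : Fin 2))).pow r
    rwa [one_mul] at this⟩

theorem symPower_val (u w : k) : (symPower r u w).1 =
    ∑ i ∈ Finset.range (r + 1), MvPolynomial.monomial (expo i (r - i))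
      (r.choose i * u ^ i * w ^ (r - i)) := by
  show (_ + _) ^ r = _
  rw [add_pow]
  refine Finset.sum_congr rfl fun i _ => ?_
  rw [mul_pow, mul_pow, ← map_pow, ← map_pow, ← map_natCast (MvPolynomial.C (σ := Fin 2) (R := k)),
    ← mul_one (_ * _ * _ : k), ← smul_eq_mul _ (1 : k), ← MvPolynomial.smul_monomial,
    ← X_pow_mul_X_pow, MvPolynomial.smul_eq_C_mul, map_mul, map_mul]
  ring

theorem symCoeff_symPower {i : ℕ} (hi : i ≤ r) (u w : k) :
    symCoeff k r i (symPower r u w) = r.choose i * u ^ i * w ^ (r - i) := by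
  classical
  rw [symCoeff_apply, symPower_val, MvPolynomial.coeff_sum, Finset.sum_eq_single i]
  · rw [MvPolynomial.coeff_monomial, if_pos rfl]
  · intro j _ hj
    rw [MvPolynomial.coeff_monomial, if_neg fun h => hj (expo_inj.1 h).1]
  · intro h
    exact absurd (Finset.mem_range.2 (by omega)) h

theorem symPower_smul (c u w : k) : symPower r (c * u) (c * w) = c ^ r • symPower r u w := by
  apply Subtype.ext
  show (_ : MvPolynomial (Fin 2) k) ^ r = c ^ r • (_ : MvPolynomial (Fin 2) k) ^ r
  rw [MvPolynomial.smul_eq_C_mul, map_pow, ← mul_pow, map_mul, map_mul]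
  ring

theorem symAct_symPower (N : Matrix (Fin 2) (Fin 2) k) (u w : k) :
    symAct k r N (symPower r u w) =
      symPower r (N 0 0 * u + N 0 1 * w) (N 1 0 * u + N 1 1 * w) := by
  apply Subtype.ext
  show subst N ((_ : MvPolynomial (Fin 2) k) ^ r) = (_ : MvPolynomial (Fin 2) k) ^ r
  simp only [subst, map_pow, map_add, map_mul, MvPolynomial.aeval_X, MvPolynomial.algHom_C,
    MvPolynomial.algebraMap_eq, Matrix.cons_val_zero, Matrix.cons_val_one]
  congr 1
  ring

theorem sym_eq_sum (v : SymPow k r) :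
    v = ∑ i : Fin (r + 1), symCoeff k r i v • symMonomial k r i := by
  classical
  apply Subtype.ext
  have h1 : (∑ i : Fin (r + 1), symCoeff k r i v • symMonomial k r i).1 =
      ∑ i : Fin (r + 1), symCoeff k r i v • (symMonomial k r i).1 :=
    map_sum (MvPolynomial.homogeneousSubmodule (Fin 2) k r).subtype _ _
  rw [h1]
  ext d
  rw [MvPolynomial.coeff_sum]
  have h2 : ∀ i : Fin (r + 1), MvPolynomial.coeff d (symCoeff k r i v • (symMonomial k r i).1) =
      if expo i (r - i) = d then symCoeff k r i v else 0 := by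
    intro i
    show MvPolynomial.coeff d (_ • (MvPolynomial.X 0 ^ (i : ℕ) * MvPolynomial.X 1 ^ (r - i))) = _
    rw [X_pow_mul_X_pow, MvPolynomial.coeff_smul, MvPolynomial.coeff_monomial]
    simp
  simp_rw [h2]
  by_cases hd : d 0 + d 1 = r
  · rw [Finset.sum_eq_single ⟨d 0, by omega⟩]
    · have : expo (d 0) (r - d 0) = d := by
        conv_rhs => rw [eq_expo d]
        rw [expo_inj]
        omega
      rw [if_pos this, symCoeff_apply, this]
    · intro i _ hi
      rw [if_neg]
      rintro rfl
      exact hi (Fin.ext (by simp [expo]))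
    · simp
  · rw [Finset.sum_eq_zero]
    · by_contra h
      apply hd
      have := v.2 h
      rw [← this]
      simp [Finsupp.weight_apply, Finsupp.sum_fintype, Fin.sum_univ_two]
    · intro i _
      rw [if_neg]
      rintro rfl
      have := i.2
      simp [expo] at hd
      omega

/-- For `r < p`, the space `Sym^r k²` is spanned by the powers of the linear forms over `𝔽_p`. -/
theorem symPower_span (hr : r ≤ p - 1) {N : Submodule k (SymPow k r)}
    (h : ∀ z : ZMod p, symPower r (algebraMap (ZMod p) k z) 1 ∈ N) : N = ⊤ := by
  have hp := (Fact.out : p.Prime).two_le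
  rw [eq_top_iff]
  rintro v -
  rw [sym_eq_sum v]
  refine N.sum_mem fun i _ => N.smul_mem _ ?_
  have hi : (i : ℕ) ≤ r := Nat.le_of_lt_succ i.2
  -- Power sums isolate a single monomial only for `i > 0`: for `i = 0` and `r = p - 1` the exponent
  -- `2 * (p - 1)` would also contribute. But `Y ^ r` is itself the power at `z = 0`.
  by_cases hi0 : (i : ℕ) = 0
  · have : symMonomial k r i = symPower r (algebraMap (ZMod p) k 0) 1 := by
      apply Subtype.ext
      show MvPolynomial.X 0 ^ (i : ℕ) * MvPolynomial.X 1 ^ (r - i) = (_ + _) ^ r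
      simp [hi0]
    rw [this]
    exact h 0
  · have hc := natCast_choose_ne_zero (p := p) k (show r < p by omega) hi
    have key : ∑ z : ZMod p, algebraMap (ZMod p) k z ^ (p - 1 - i) •
        symPower r (algebraMap (ZMod p) k z) 1 = (-(r.choose i : k)) • symMonomial k r i := by
      rw [sym_eq_sum (∑ z : ZMod p, _), Finset.sum_eq_single i]
      · simp_rw [map_sum, map_smul, symCoeff_symPower hi, smul_eq_mul, one_pow, mul_one,
          mul_left_comm _ (r.choose i : k), ← pow_add]
        rw [← Finset.mul_sum, Nat.sub_add_cancel (by omega), sum_pow_card_sub_one, mul_neg_one]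
      · intro j _ hj
        have hj' : (j : ℕ) ≠ i := fun e => hj (Fin.ext e)
        have hjr := j.2
        simp_rw [map_sum, map_smul, symCoeff_symPower (Nat.le_of_lt_succ hjr), smul_eq_mul,
          one_pow, mul_one, mul_left_comm _ (r.choose j : k), ← pow_add]
        rw [← Finset.mul_sum, sum_pow_eq_zero (by omega) (by omega), mul_zero, zero_smul]
      · simp
    have := N.sum_mem fun (z : ZMod p) (_ : z ∈ Finset.univ) =>
      N.smul_mem (algebraMap (ZMod p) k z ^ (p - 1 - i)) (h z)
    rw [key] at this
    exact (N.smul_mem_iff (neg_ne_zero.2 hc)).1 this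

/-- The coefficient of `X ^ i * Y ^ (r - i)` in the first sum is a multiple of `∑ z ^ i`, which is
nonzero only for `i = p - 1`. This happens exactly when `r = p - 1`, and the extra `X ^ r` cancels
it. -/
theorem sum_symPower (hr : r ≤ p - 1) : ∑ z : ZMod p, symPower r (algebraMap (ZMod p) k z) 1 +
    (if r = p - 1 then (1 : k) else 0) • symPower r 1 0 = 0 := by
  have hp := (Fact.out : p.Prime).two_le
  rw [sym_eq_sum (_ + _)]
  refine Finset.sum_eq_zero fun i _ => ?_
  have hi : (i : ℕ) ≤ r := Nat.le_of_lt_succ i.2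
  simp_rw [map_add, map_sum, map_smul, symCoeff_symPower hi, one_pow, mul_one]
  rw [← Finset.mul_sum]
  by_cases h : (i : ℕ) = p - 1
  · rw [h, sum_pow_card_sub_one, if_pos (by omega), Nat.sub_eq_zero_of_le hr,
      show r.choose (p - 1) = 1 by rw [show r = p - 1 by omega, Nat.choose_self]]
    simp
  · rw [sum_pow_eq_zero (by omega) h]
    split_ifs with hr'
    · rw [zero_pow (by omega)]
      simp
    · simp

/-- A family indexed by `ℙ¹(𝔽_p)` which satisfies the linear relations between the powers
`(zX + Y) ^ r` and `X ^ r` is the image of these powers under a linear map. -/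
theorem exists_symPower_lift (hr : r ≤ p - 1) {e : ZMod p → M} {e' : M}
    (hw : ∀ y, ∑ z, algebraMap (ZMod p) k (z - y) ^ (p - 1 - r) • e z + e' = 0) :
    ∃ ψ : SymPow k r →ₗ[k] M,
      (∀ z, ψ (symPower r (algebraMap (ZMod p) k z) 1) = e z) ∧ ψ (symPower r 1 0) = e' := by
  have hp := (Fact.out : p.Prime).two_le
  set f := algebraMap (ZMod p) k
  set m : ℕ → M := fun j => ∑ z, f z ^ j • e z with hm
  have hlow : ∀ j < p - 1 - r, m j = 0 := fun j hj => moment_eq_zero (by omega) hw hj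
  have htop : m (p - 1 - r) = -e' := by
    rw [eq_neg_iff_add_eq_zero]
    simpa using hw 0
  -- Interpolation has degree `p - 1` in `z`; the vanishing of the low moments removes all powers
  -- above `z ^ r`.
  have hm0 : ∀ z, e z = e 0 - ∑ i ∈ Finset.range r, f z ^ (i + 1) • m (p - 1 - (i + 1)) := by
    intro z
    rw [eq_sub_sum_moments (k := k) e z]
    congr 1
    obtain ⟨l, hl⟩ := Nat.exists_eq_add_of_le hr
    rw [hl, Finset.sum_range_add, ← hl, add_eq_left]
    refine Finset.sum_eq_zero fun i hi => ?_
    have := Finset.mem_range.1 hi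
    have e1 := hlow (p - 1 - (r + i + 1)) (by omega)
    simp only [hm] at e1
    rw [e1, smul_zero]
  -- The intended images of the monomials: `(zX + Y) ^ r` has coefficient `r.choose i * z ^ i`, so
  -- dividing by the binomial coefficient matches the expansion of `e z` power by power.
  let c : ℕ → M := fun i => if i = 0 then e 0 else -((r.choose i : k)⁻¹ • m (p - 1 - i))
  let ψ : SymPow k r →ₗ[k] M := ∑ i ∈ Finset.range (r + 1), (symCoeff k r i).smulRight (c i)
  have hψ : ∀ u w : k, ψ (symPower r u w) =
      ∑ i ∈ Finset.range (r + 1), (r.choose i * u ^ i * w ^ (r - i)) • c i := by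
    intro u w
    simp only [ψ, LinearMap.sum_apply, LinearMap.smulRight_apply]
    refine Finset.sum_congr rfl fun i hi => ?_
    rw [symCoeff_symPower (Nat.le_of_lt_succ (Finset.mem_range.1 hi))]
  refine ⟨ψ, fun z => ?_, ?_⟩
  · rw [hψ, Finset.sum_range_succ', hm0 z, sub_eq_neg_add, ← Finset.sum_neg_distrib]
    congr 1
    · refine Finset.sum_congr rfl fun i hi => ?_
      have hc := natCast_choose_ne_zero (p := p) k (show r < p by omega)
        (show i + 1 ≤ r from Finset.mem_range.1 hi)
      simp only [c, Nat.add_eq_zero_iff, one_ne_zero, and_false, if_false, one_pow, mul_one,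
        smul_neg, smul_smul]
      rw [mul_right_comm, mul_inv_cancel₀ hc, one_mul]
    · simp [c]
  · rw [hψ, Finset.sum_range_succ, Finset.sum_eq_zero, zero_add]
    -- For `r = 0` the image of `X ^ r` is `c 0 = e 0` rather than a top moment. It still equals
    -- `e'`, since `e 0 = m 0 - m (p - 1)` and `m 0` vanishes.
    · by_cases hr0 : r = 0
      · subst hr0
        have h1 : m 0 = 0 := hlow 0 (by omega)
        have h2 : e 0 = m 0 - m (p - 1) := by
          simp [hm, f, algebraMap_pow_card_sub_one, sub_smul]
        simp only [Nat.sub_zero] at htop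
        simp [c, h2, h1, htop]
      · simp [c, hr0, htop]
    · intro i hi
      rw [zero_pow (by have := Finset.mem_range.1 hi; omega), mul_zero, zero_smul]

end SymPow

/-! ### The comparison map -/

section Comparison

variable {p : ℕ} [Fact p.Prime] {k : Type*} [Field k] [Algebra (ZMod p) k] {r : ℕ}

theorem red_teich (x : ZMod p) : red p k (teich p x) = algebraMap (ZMod p) k x := by
  rw [red, RingHom.comp_apply, toZMod_teich]

theorem red_p : red p k (p : ℤ_[p]) = 0 := by
  rw [red, RingHom.comp_apply, toZMod_p, map_zero]

theorem red_iwahori {g : GL (Fin 2) ℤ_[p]} (hg : g ∈ iwahori p) : red p k (g.1 1 0) = 0 := by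
  rw [red, RingHom.comp_apply, show PadicInt.toZMod (g.1 1 0) = 0 from hg, map_zero]

/-- Conjugation by `β` preserves the Iwahori subgroup and exchanges the diagonal entries. -/
theorem exists_iwahori_mul_matBeta {h : GL (Fin 2) ℤ_[p]} (hh : h ∈ iwahori p)
    (n : Multiplicative ℤ) : ∃ h' ∈ iwahori p, h'.1 0 0 = h.1 1 1 ∧ h'.1 1 1 = h.1 0 0 ∧
      inclKZ p (h, n) * matBeta p = matBeta p * inclKZ p (h', n) := by
  obtain ⟨c, hc⟩ := toZMod_eq_zero (show PadicInt.toZMod (h.1 1 0) = 0 from hh)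
  have hne : (!![0, 1; (p : ℤ_[p]), 0]).det ≠ 0 := by
    simpa [Matrix.det_fin_two_of] using p_ne_zero p
  have e : h.1 * !![0, 1; (p : ℤ_[p]), 0] =
      !![0, 1; (p : ℤ_[p]), 0] * !![h.1 1 1, c; p * h.1 0 1, h.1 0 0] := by
    ext i j
    fin_cases i <;> fin_cases j <;> simp [Matrix.mul_apply, Fin.sum_univ_two, hc, mul_comm]
  obtain ⟨h', hh'⟩ := exists_GL hne rfl e
  refine ⟨h', ?_, by simp [hh'], by simp [hh'], incl_mul_toGL hne hne (by rw [e, hh']) n⟩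
  show PadicInt.toZMod (h'.1 1 0) = 0
  simp [hh']

theorem matBeta_mul_matBeta : matBeta p * matBeta p = inclKZ p (1, .ofAdd 1) := by
  apply Units.ext
  ext i j
  fin_cases i <;> fin_cases j <;>
    simp [matBeta, toGL, inclKZ, pScalar, Matrix.mul_apply, Fin.sum_univ_two, Matrix.natCast_apply]

theorem inclIZ_apply (h : iwahori p) (n : Multiplicative ℤ) :
    inclIZ p (h, n) = inclKZ p (h.1, n) := rfl

theorem elemIZ_mul (g : GL (Fin 2) ℚ_[p]) {h : GL (Fin 2) ℤ_[p]} (hh : h ∈ iwahori p)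
    (n : Multiplicative ℤ) (v : k) : elemIZ p k r (g * inclKZ p (h, n)) v =
      elemIZ p k r g (red p k (h.1 1 1) ^ r * v) :=
  elem_mul inclIZ_injective g (⟨h, hh⟩, n) v

theorem elemIZ_mul_matBeta (g : GL (Fin 2) ℚ_[p]) {h : GL (Fin 2) ℤ_[p]} (hh : h ∈ iwahori p)
    (n : Multiplicative ℤ) (v : k) : elemIZ p k r (g * inclKZ p (h, n) * matBeta p) v =
      elemIZ p k r (g * matBeta p) (red p k (h.1 0 0) ^ r * v) := by
  obtain ⟨h', hh', -, e, e'⟩ := exists_iwahori_mul_matBeta hh n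
  rw [mul_assoc, e', ← mul_assoc, elemIZ_mul _ hh', e]

theorem elemIZ_mul_matBeta_mul_matBeta (g : GL (Fin 2) ℚ_[p]) (v : k) :
    elemIZ p k r (g * matBeta p * matBeta p) v = elemIZ p k r g v := by
  rw [mul_assoc, matBeta_mul_matBeta, elemIZ_mul _ (one_mem _)]
  simp

theorem elemKZ_mul (g : GL (Fin 2) ℚ_[p]) (h : GL (Fin 2) ℤ_[p]) (n : Multiplicative ℤ)
    (u w : k) : elemKZ p k r (g * inclKZ p (h, n)) (symPower r u w) =
      elemKZ p k r g (symPower r (red p k (h.1 0 0) * u + red p k (h.1 0 1) * w)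
        (red p k (h.1 1 0) * u + red p k (h.1 1 1) * w)) := by
  rw [elemKZ, elem_mul]
  exact congrArg _ (symAct_symPower _ u w)

variable (p k r) in
/-- The equivariant map `ind_{IZ}^G d^r → ind_{KZ}^G V_r` with `⟦g, v⟧ ↦ [g β, v X ^ r]`. -/
noncomputable def comparison :
    cIndV (inclIZ p) (dChar p k r) →ₗ[k] cIndV (inclKZ p) (weight p k r) :=
  cIndLift (inclIZ p) (dChar p k r) (cInd (inclKZ p) (weight p k r))
    (LinearMap.toSpanSingleton k _ (elemKZ p k r (matBeta p) (symPower r 1 0)))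

/-- Moving `h` past `β` replaces it by an Iwahori element with upper left entry `d`. That element
acts on `X ^ r` by `d ^ r`, since its lower left entry vanishes mod `p`. -/
theorem comparison_equivariant_aux (h : iwahori p × Multiplicative ℤ) (v : k) :
    LinearMap.toSpanSingleton k _ (elemKZ p k r (matBeta p) (symPower r 1 0)) (dChar p k r h v) =
      cInd (inclKZ p) (weight p k r) (inclIZ p h)
        (LinearMap.toSpanSingleton k _ (elemKZ p k r (matBeta p) (symPower r 1 0)) v) := by
  obtain ⟨⟨h, hh⟩, n⟩ := h
  obtain ⟨h', hh', e, -, e'⟩ := exists_iwahori_mul_matBeta hh n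
  rw [LinearMap.toSpanSingleton_apply, LinearMap.toSpanSingleton_apply, map_smul, elemKZ,
    cInd_elem, inclIZ_apply, e', ← elemKZ, ← elemKZ, elemKZ_mul, red_iwahori hh', e]
  have := symPower_smul (r := r) (red p k (h.1 1 1)) 1 0
  rw [mul_one, mul_zero] at this
  simp only [mul_one, mul_zero, add_zero]
  rw [this, elemKZ, elemKZ, elem_smul, smul_smul, mul_comm v]
  rfl

theorem comparison_elem (g : GL (Fin 2) ℚ_[p]) (v : k) : comparison p k r (elemIZ p k r g v) =
    v • elemKZ p k r (g * matBeta p) (symPower r 1 0) := by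
  refine (cIndLift_elem inclIZ_injective comparison_equivariant_aux g v).trans ?_
  rw [LinearMap.toSpanSingleton_apply, map_smul, elemKZ, cInd_elem]
  rfl

theorem comparison_equivariant (g : GL (Fin 2) ℚ_[p]) (f : cIndV (inclIZ p) (dChar p k r)) :
    comparison p k r (cInd _ _ g f) = cInd _ _ g (comparison p k r f) :=
  cIndLift_equivariant inclIZ_injective comparison_equivariant_aux g f

/-- The element `([x] 1; 1 0)` of `GL₂(ℤ_p)`. -/
noncomputable def kappa (x : ZMod p) : GL (Fin 2) ℤ_[p] where
  val := !![teich p x, 1; 1, 0]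
  inv := !![0, 1; 1, -teich p x]
  val_inv := by simp [Matrix.one_fin_two]
  inv_val := by simp [Matrix.one_fin_two]

theorem kappa_val (x : ZMod p) : (kappa x).1 = !![teich p x, 1; 1, 0] := rfl

theorem kappa_inv_val (x : ZMod p) : ((kappa x)⁻¹).1 = !![0, 1; 1, -teich p x] := rfl

/-- This exhibits the matrices in `T_{-1,0}` as `K`-translates of `β`, indexed by the points `(x :
1)` of `ℙ¹(𝔽_p)`. -/
theorem inclKZ_kappa_mul_matBeta (x : ZMod p) :
    inclKZ p (kappa x, 1) * matBeta p = matSource p x := by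
  apply Units.ext
  ext i j
  fin_cases i <;> fin_cases j <;>
    simp [matBeta, matSource, toGL, inclKZ, inclK, kappa_val, Matrix.mul_apply, Fin.sum_univ_two]

/-- The translates of `⟦β, v⟧` by `GL₂(ℤ_p)` in terms of representatives of `ℙ¹(𝔽_p)`. -/
theorem elemIZ_mul_matBeta_of_eq (κ : GL (Fin 2) ℤ_[p]) (n : Multiplicative ℤ) {z : ZMod p}
    (h : PadicInt.toZMod (κ.1 0 0) = z * PadicInt.toZMod (κ.1 1 0)) (v : k) :
    elemIZ p k r (inclKZ p (κ, n) * matBeta p) v =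
      elemIZ p k r (matSource p z) (red p k (κ.1 1 0) ^ r * v) := by
  have e : ∀ j, ((kappa z)⁻¹ * κ).1 0 j = κ.1 1 j ∧
      ((kappa z)⁻¹ * κ).1 1 j = κ.1 0 j - teich p z * κ.1 1 j := fun j => by
    rw [Units.val_mul, kappa_inv_val]
    constructor <;> simp [Matrix.mul_apply, Fin.sum_univ_two, sub_eq_add_neg]
  -- The coset of `κ` modulo `I` is determined by its first column as a point of `ℙ¹(𝔽_p)`, here `(z
  -- : 1)`. The upper left entry of the quotient is the scalar that is passed to the character after
  -- crossing `β`.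
  have hI : (kappa z)⁻¹ * κ ∈ iwahori p := by
    show PadicInt.toZMod (((kappa z)⁻¹ * κ).1 1 0) = 0
    rw [(e 0).2, map_sub, map_mul, toZMod_teich, h, sub_self]
  have e2 : inclKZ p (κ, n) = inclKZ p (kappa z, 1) * inclKZ p ((kappa z)⁻¹ * κ, n) := by
    rw [← map_mul]
    simp
  rw [e2, elemIZ_mul_matBeta _ hI, inclKZ_kappa_mul_matBeta, (e 0).1]

variable (p k r) in
/-- The operator `T_{-1,0} + δ_{r,p-1} T_{1,0}`. -/
noncomputable def sourceOp : Module.End k (cIndV (inclIZ p) (dChar p k r)) :=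
  heckeSource p k r + (if r = p - 1 then (1 : k) else 0) • heckeFlip p k r

theorem sourceOp_elem (g : GL (Fin 2) ℚ_[p]) (v : k) : sourceOp p k r (elemIZ p k r g v) =
    ∑ x, elemIZ p k r (g * matSource p x) v +
      (if r = p - 1 then (1 : k) else 0) • elemIZ p k r (g * matBeta p) v := by
  rw [sourceOp, LinearMap.add_apply, heckeSource_elem, LinearMap.smul_apply]
  split_ifs with h
  · rw [heckeFlip_elem (Or.inr h)]
  · simp

theorem sourceOp_comm (g : GL (Fin 2) ℚ_[p]) (f : cIndV (inclIZ p) (dChar p k r)) :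
    sourceOp p k r (cInd _ _ g f) = cInd _ _ g (sourceOp p k r f) := by
  simp only [sourceOp, LinearMap.add_apply, LinearMap.smul_apply, map_add, map_smul,
    heckeSource_comm]
  split_ifs with h
  · rw [heckeFlip_comm (Or.inr h)]
  · simp

theorem range_sourceOp_stable (g : GL (Fin 2) ℚ_[p]) :
    LinearMap.range (sourceOp p k r) ≤ (LinearMap.range (sourceOp p k r)).comap (cInd _ _ g) := by
  rintro _ ⟨f, rfl⟩
  exact ⟨cInd _ _ g f, sourceOp_comm g f⟩

theorem elemIZ_eq_smul (g : GL (Fin 2) ℚ_[p]) (v : k) :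
    elemIZ p k r g v = v • elemIZ p k r g 1 := by
  rw [elemIZ, elemIZ, ← elem_smul, smul_eq_mul, mul_one]

theorem teich_zero : teich p 0 = 0 := by simp [teich]

/-- These are the relations required by `exists_symPower_lift`: the translate of the basic relation
by `κ_y` moves the points of `ℙ¹(𝔽_p)` by `x ↦ y + 1 / x`. -/
theorem sourceOp_kappa (hr : r ≤ p - 1) (y : ZMod p) :
    sourceOp p k r (elemIZ p k r (inclKZ p (kappa y, 1)) 1) =
      ∑ z, algebraMap (ZMod p) k (z - y) ^ (p - 1 - r) • elemIZ p k r (matSource p z) 1 +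
        elemIZ p k r (matBeta p) 1 := by
  have hp := (Fact.out : p.Prime).two_le
  -- The first column of `κ_y κ_x` is `(yx + 1, x)`, that is, the point `y + x⁻¹` with scalar `x`.
  -- Its `r`-th power equals `(x⁻¹) ^ (p - 1 - r)` because `x ^ (p - 1) = 1`.
  have h1 : ∀ x : ZMod p, x ≠ 0 → elemIZ p k r (inclKZ p (kappa y, 1) * matSource p x) 1 =
      algebraMap (ZMod p) k x⁻¹ ^ (p - 1 - r) • elemIZ p k r (matSource p (y + x⁻¹)) 1 := by
    intro x hx
    rw [← inclKZ_kappa_mul_matBeta, ← mul_assoc, ← map_mul, Prod.mk_mul_mk, mul_one,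
      elemIZ_mul_matBeta_of_eq (z := y + x⁻¹), mul_one, elemIZ_eq_smul]
    · congr 1
      have e : ((kappa y * kappa x).1 1 0) = teich p x := by
        simp [kappa_val]
      rw [e, red_teich, ← map_pow, ← map_pow, inv_pow]
      congr 1
      rw [inv_eq_of_mul_eq_one_left]
      rw [← pow_add, Nat.add_sub_cancel' hr,
        ZMod.pow_card_sub_one_eq_one hx]
    · simp [kappa_val, toZMod_teich, add_mul, hx]
  have h0 : elemIZ p k r (inclKZ p (kappa y, 1) * matSource p 0) 1 =
      elemIZ p k r (matBeta p) (1 : k) := by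
    have hI : kappa y * kappa 0 ∈ iwahori p := by
      show PadicInt.toZMod ((kappa y * kappa 0).1 1 0) = 0
      simp [kappa_val, teich_zero]
    have e : (kappa y * kappa 0).1 0 0 = 1 := by simp [kappa_val, teich_zero]
    have := elemIZ_mul_matBeta (k := k) (r := r) 1 hI 1 1
    rw [one_mul, one_mul, e, map_one, one_pow, mul_one] at this
    rw [← this, ← inclKZ_kappa_mul_matBeta, ← mul_assoc, ← map_mul, Prod.mk_mul_mk, mul_one]
  -- Since `0⁻¹ = 0`, the substitution `z = y + x⁻¹` is a bijection of `𝔽_p` and pairs `x = 0` with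
  -- `z = y`.
  have h3 := ((Equiv.inv (ZMod p)).trans (Equiv.addLeft y)).sum_comp fun z =>
    algebraMap (ZMod p) k (z - y) ^ (p - 1 - r) • elemIZ p k r (matSource p z) 1
  simp only [Equiv.trans_apply, Equiv.inv_apply, Equiv.coe_addLeft, add_sub_cancel_left] at h3
  rw [sourceOp_elem, inclKZ_kappa_mul_matBeta, ← h3]
  rw [← Finset.add_sum_erase _ _ (Finset.mem_univ (0 : ZMod p)),
    ← Finset.add_sum_erase _ _ (Finset.mem_univ (0 : ZMod p)), h0,
    Finset.sum_congr rfl fun x hx => h1 x (Finset.ne_of_mem_erase hx)]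
  -- The term at `z = y` has coefficient `0 ^ (p - 1 - r)`, which is `δ_{r,p-1}`: it is exactly the
  -- contribution of `T_{1,0}`, while the `x = 0` term of `T_{-1,0}` supplies `⟦β, 1⟧`.
  have h2 : algebraMap (ZMod p) k (0 : ZMod p)⁻¹ ^ (p - 1 - r) =
      if r = p - 1 then (1 : k) else 0 := by
    rw [inv_zero, map_zero, zero_pow_eq]
    exact if_congr (by omega) rfl rfl
  rw [h2, inv_zero, add_zero]
  abel

end Comparison

/-! ### Surjectivity, kernel and Hecke equivariance of the comparison map -/

section Isomorphism

variable {p : ℕ} [Fact p.Prime] {k : Type*} [Field k] [Algebra (ZMod p) k] {r : ℕ}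

theorem comparison_elem_matSource (g : GL (Fin 2) ℚ_[p]) (x : ZMod p) (v : k) :
    comparison p k r (elemIZ p k r (g * matSource p x) v) =
      v • elemKZ p k r g (symPower r (algebraMap (ZMod p) k x) 1) := by
  have h : matSource p x * matBeta p = inclKZ p (kappa x, .ofAdd 1) := by
    rw [← inclKZ_kappa_mul_matBeta, mul_assoc, matBeta_mul_matBeta, ← map_mul, Prod.mk_mul_mk,
      mul_one, one_mul]
  rw [comparison_elem, mul_assoc, h, elemKZ_mul]
  simp [kappa_val, red_teich]

/-- For each `g` the image contains `[g, (zX + Y) ^ r]` for all `z` in `𝔽_p`, and these powers span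
`V_r`. -/
theorem comparison_surjective (hr : r ≤ p - 1) : Function.Surjective (comparison p k r) := by
  rw [← LinearMap.range_eq_top]
  refine cIndV_submodule_eq_top inclKZ_injective fun g => ?_
  have : (LinearMap.range (comparison p k r)).comap
      (elemMap inclKZ_injective (weight p k r) g) = ⊤ := by
    refine symPower_span hr fun z => ⟨elemIZ p k r (g * matSource p z) 1, ?_⟩
    rw [comparison_elem_matSource, one_smul]
    rfl
  intro v
  have hv : v ∈ (LinearMap.range (comparison p k r)).comap
      (elemMap inclKZ_injective (weight p k r) g) := this ▸ Submodule.mem_top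
  exact hv

/-- Passing through `β` turns the matrices of `T_{1,2}` into those of `T`. -/
theorem matSink_mul_matBeta (x : ZMod p) :
    matSink p x * matBeta p = matBeta p * matSource p x := by
  apply Units.ext
  ext i j
  fin_cases i <;> fin_cases j <;>
    simp [matBeta, matSource, matSink, toGL, Matrix.mul_apply, Fin.sum_univ_two, mul_comm]

theorem matBeta_mul_matAlpha : matBeta p * matAlpha p = inclKZ p (kappa 0, .ofAdd 1) := by
  apply Units.ext
  ext i j
  fin_cases i <;> fin_cases j <;>
    simp [matBeta, matAlpha, toGL, inclKZ, inclK, pScalar, kappa_val, teich_zero, Matrix.mul_apply,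
      Fin.sum_univ_two, Matrix.natCast_apply]

variable (p k r) in
/-- The operator `T_{1,2} + δ_{r,0} T_{1,0}`. -/
noncomputable def sinkOp : Module.End k (cIndV (inclIZ p) (dChar p k r)) :=
  heckeSink p k r + (if r = 0 then (1 : k) else 0) • heckeFlip p k r

theorem sinkOp_elem (g : GL (Fin 2) ℚ_[p]) (v : k) : sinkOp p k r (elemIZ p k r g v) =
    ∑ x, elemIZ p k r (g * matSink p x) v +
      (if r = 0 then (1 : k) else 0) • elemIZ p k r (g * matBeta p) v := by
  rw [sinkOp, LinearMap.add_apply, heckeSink_elem, LinearMap.smul_apply]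
  split_ifs with h
  · rw [heckeFlip_elem (Or.inl h)]
  · simp

/-- The comparison map intertwines `T_{1,2} + δ_{r,0} T_{1,0}` and `T`. -/
theorem comparison_comp_sinkOp :
    comparison p k r ∘ₗ sinkOp p k r = heckeT p k r ∘ₗ comparison p k r := by
  refine cIndV_hom_ext inclIZ_injective fun g v => ?_
  show comparison p k r (sinkOp p k r (elemIZ p k r g v)) =
    heckeT p k r (comparison p k r (elemIZ p k r g v))
  rw [comparison_elem, map_smul, heckeT_elem, sinkOp_elem, map_add, map_sum, map_smul, smul_add,
    Finset.smul_sum]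
  congr 1
  -- The substitution `v(X, -[x]X + pY)` fixes `X ^ r`, so the terms agree one by one.
  · refine Finset.sum_congr rfl fun x _ => ?_
    rw [comparison_elem, mul_assoc, matSink_mul_matBeta, ← mul_assoc, symAct_symPower]
    simp
  · rw [comparison_elem, symAct_symPower, mul_assoc g, mul_assoc g, matBeta_mul_matAlpha,
      matBeta_mul_matBeta, elemKZ_mul, elemKZ_mul]
    split_ifs with h
    -- The last term of `T` carries `(pX) ^ r`, which is `1` for `r = 0`. Since `βα` and `β²` lie in
    -- `KZ`, which acts trivially on `V_0`, it agrees with the term of `T_{1,0}`.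
    · subst h
      have : ∀ u w u' w' : k, symPower 0 u w = symPower 0 u' w' := fun _ _ _ _ =>
        Subtype.ext (by simp [symPower])
      rw [one_smul]
      exact congrArg (fun s => v • elemKZ p k 0 g s) (this _ _ _ _)
    -- For `r > 0` the factor `(pX) ^ r` vanishes mod `p`, so there is nothing for `T_{1,0}` to
    -- match.
    · have : symPower r (0 : k) 0 = 0 := by
        apply Subtype.ext
        show (_ : MvPolynomial (Fin 2) k) ^ r = 0
        simp [h]
      simp [kappa_val, teich_zero, this, elemKZ, elem_zero, red_p, -map_natCast]

theorem comparison_comp_sourceOp (hr : r ≤ p - 1) :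
    comparison p k r ∘ₗ sourceOp p k r = 0 := by
  refine cIndV_hom_ext inclIZ_injective fun g v => ?_
  show comparison p k r (sourceOp p k r (elemIZ p k r g v)) = 0
  have h1 : elemKZ p k r (g * matBeta p * matBeta p) (symPower r 1 0) =
      elemKZ p k r g (symPower r 1 0) := by
    rw [mul_assoc, matBeta_mul_matBeta, elemKZ_mul]
    simp
  rw [sourceOp_elem, map_add, map_sum, map_smul, comparison_elem, h1, smul_comm]
  simp_rw [comparison_elem_matSource]
  rw [← Finset.smul_sum, ← smul_add]
  have h2 := congrArg (elemMap inclKZ_injective (weight p k r) g) (sum_symPower (k := k) hr)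
  rw [map_add, map_sum, map_smul, map_zero] at h2
  exact (congrArg (v • ·) h2).trans (smul_zero v)

/-- The kernel of the comparison map is the image of `T_{-1,0} + δ_{r,p-1} T_{1,0}`. -/
theorem ker_comparison_le (hr : r ≤ p - 1) :
    LinearMap.ker (comparison p k r) ≤ LinearMap.range (sourceOp p k r) := by
  set A := LinearMap.range (sourceOp p k r) with hA
  let σ := (cInd (inclIZ p) (dChar p k r)).quotient A range_sourceOp_stable
  have hσ : ∀ g x v, σ g (A.mkQ (elemIZ p k r x v)) = A.mkQ (elemIZ p k r (g * x) v) :=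
    fun g x v => congrArg A.mkQ (cInd_elem inclIZ_injective g x v)
  -- The candidate for the inverse on `V_r`, with values in the quotient by `A`.
  obtain ⟨ψ, hψ, hψ'⟩ := exists_symPower_lift (p := p) (k := k) hr
    (e := fun z => A.mkQ (elemIZ p k r (matSource p z) 1))
    (e' := A.mkQ (elemIZ p k r (matBeta p) 1)) (fun y => by
      simp_rw [← map_smul, ← map_sum, ← map_add, ← sourceOp_kappa hr y]
      exact (Submodule.Quotient.mk_eq_zero _).2 ⟨_, rfl⟩)
  -- The description of `ψ` extends from the chosen representatives to every first column `(a, c)`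
  -- of an element of `GL₂(ℤ_p)`, because both sides scale by the `r`-th power. In this form it is
  -- visibly compatible with left multiplication.
  have hκ : ∀ (κ : GL (Fin 2) ℤ_[p]) (n : Multiplicative ℤ),
      ψ (symPower r (red p k (κ.1 0 0)) (red p k (κ.1 1 0))) =
        A.mkQ (elemIZ p k r (inclKZ p (κ, n) * matBeta p) 1) := by
    intro κ n
    by_cases hc : PadicInt.toZMod (κ.1 1 0) = 0
    · have := elemIZ_mul_matBeta (k := k) (r := r) 1 (show κ ∈ iwahori p from hc) n 1
      rw [one_mul, one_mul] at this
      rw [this, elemIZ_eq_smul, map_smul, ← hψ', ← map_smul, mul_one, ← symPower_smul, mul_one,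
        mul_zero, red_iwahori hc]
    · have h1 : PadicInt.toZMod (κ.1 0 0) =
          PadicInt.toZMod (κ.1 0 0) / PadicInt.toZMod (κ.1 1 0) * PadicInt.toZMod (κ.1 1 0) := by
        field_simp
      rw [elemIZ_mul_matBeta_of_eq κ n h1, elemIZ_eq_smul, map_smul, ← hψ, ← map_smul, mul_one,
        ← symPower_smul, mul_one]
      congr 2
      simp only [red, RingHom.comp_apply]
      rw [← map_mul, mul_comm, ← h1]
  have heq : ∀ h v, ψ (weight p k r h v) = σ (inclKZ p h) (ψ v) := by
    rintro ⟨h, n⟩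
    -- Equivariance need only be tested on the spanning powers `(zX + Y) ^ r`, where it is `hκ` for
    -- `h * kappa z`.
    have : LinearMap.eqLocus (ψ ∘ₗ weight p k r (h, n)) (σ (inclKZ p (h, n)) ∘ₗ ψ) = ⊤ := by
      refine symPower_span hr fun z => ?_
      show ψ (symAct k r ((red p k).mapMatrix h.1) _) = σ (inclKZ p (h, n)) (ψ _)
      have h1 := hκ (h * kappa z) n
      rw [hψ, hσ, ← inclKZ_kappa_mul_matBeta, ← mul_assoc, ← map_mul, Prod.mk_mul_mk, mul_one, ← h1,
        symAct_symPower]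
      congr 2 <;> simp [kappa_val, Matrix.mul_apply, Fin.sum_univ_two, red_teich]
    intro v
    have hv : v ∈ LinearMap.eqLocus (ψ ∘ₗ weight p k r (h, n)) (σ (inclKZ p (h, n)) ∘ₗ ψ) :=
      this ▸ Submodule.mem_top
    exact hv
  -- The composite sends `⟦g, v⟧` to the class of `⟦gβ², v⟧`, and `β²` is the scalar `p`, which acts
  -- trivially.
  have key : cIndLift (inclKZ p) (weight p k r) σ ψ ∘ₗ comparison p k r = A.mkQ := by
    refine cIndV_hom_ext inclIZ_injective fun g v => ?_
    show cIndLift (inclKZ p) (weight p k r) σ ψ (comparison p k r (elemIZ p k r g v)) =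
      A.mkQ (elemIZ p k r g v)
    rw [comparison_elem, map_smul, elemKZ, cIndLift_elem inclKZ_injective heq, hψ', hσ,
      elemIZ_mul_matBeta_mul_matBeta, elemIZ_eq_smul g v, map_smul]
  rw [← A.ker_mkQ, ← key]
  exact LinearMap.ker_le_ker_comp _ _

/-- If the image of `f` is `(T - λ) F`, lift `F` to some `f'`; subtracting `(T_{1,2} + δ_{r,0}
T_{1,0} - λ) f'` from `f` leaves an element of the kernel, which is the image of `T_{-1,0} +
δ_{r,p-1} T_{1,0}`. -/
theorem comap_comparison (hr : r ≤ p - 1) (lam : k) :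
    (sphericalRel p k r lam).comap (comparison p k r) = iwahoriRel p k r lam := by
  have h1 : ∀ f, comparison p k r (sinkOp p k r f - lam • f) =
      heckeT p k r (comparison p k r f) - lam • comparison p k r f := fun f => by
    have := LinearMap.congr_fun (comparison_comp_sinkOp (p := p) (k := k) (r := r)) f
    simp only [LinearMap.comp_apply] at this
    rw [map_sub, map_smul, this]
  apply le_antisymm
  · rintro f ⟨F, hF⟩
    obtain ⟨f', rfl⟩ := comparison_surjective hr F
    have h2 : f - (sinkOp p k r f' - lam • f') ∈ LinearMap.range (sourceOp p k r) := by
      apply ker_comparison_le hr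
      rw [LinearMap.mem_ker, map_sub, h1, sub_eq_zero]
      exact hF.symm
    rw [← sub_add_cancel f (sinkOp p k r f' - lam • f')]
    exact Submodule.add_mem_sup h2 ⟨f', rfl⟩
  · refine sup_le ?_ ?_
    · rintro _ ⟨f, rfl⟩
      refine ⟨0, ?_⟩
      rw [map_zero]
      exact (LinearMap.congr_fun (comparison_comp_sourceOp hr) f).symm
    · rintro _ ⟨f, rfl⟩
      exact ⟨comparison p k r f, (h1 f).symm⟩

end Isomorphism
end ABC

/-! ### Passage to the quotients and the twist by `η` -/

theorem mainTheorem4 (p : ℕ) [Fact p.Prime] (k : Type*) [Field k] [Algebra (ZMod p) k]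
    (r : ℕ) (hr : r ≤ p - 1) (lam : k)
    (η : ℚ_[p]ˣ →* kˣ) (hη : IsOpen (η.ker : Set ℚ_[p]ˣ)) :
    Nonempty ((ABC.sphericalPi p k r lam η).Equiv (ABC.iwahoriPi p k r lam η)) := by
  have hcomap := ABC.comap_comparison hr lam
  let e : (_ ⧸ ABC.iwahoriRel p k r lam) →ₗ[k] (_ ⧸ ABC.sphericalRel p k r lam) :=
    Submodule.mapQ _ _ (ABC.comparison p k r) hcomap.ge
  have he : Function.Bijective e := by
    constructor
    · rw [← LinearMap.ker_eq_bot, Submodule.ker_mapQ, hcomap, Submodule.mkQ_map_self]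
    · rintro ⟨y⟩
      obtain ⟨f, rfl⟩ := ABC.comparison_surjective hr y
      exact ⟨Submodule.Quotient.mk f, rfl⟩
  refine ⟨(Representation.Equiv.mk (LinearEquiv.ofBijective e he) fun g => ?_).symm⟩
  apply LinearMap.ext
  rintro ⟨f⟩
  -- Both twists multiply the action of `g` by the same scalar `η (det g)`, so equivariance reduces
  -- to that of the comparison map.
  let c : k := (η (Matrix.GeneralLinearGroup.det g) : kˣ)
  exact (e.map_smul c (Submodule.Quotient.mk (ABC.cInd _ _ g f))).trans
    (congrArg (fun y => c • Submodule.Quotient.mk y) (ABC.comparison_equivariant g f))
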